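/- Let $S$ be a finite alphabet, $A\subseteq S\times S$ a transition relation, and let $\Sigma=\{\omega\in S^{\mathbb N}:(\omega_n,\omega_{n+1})\in A\ \forall n\ge 0\}$ be the corresponding one-sided topological Markov shift, assumed non-empty, with the metric $d(\omega,\omega')=2^{-\min\{n:\omega_n\neq\omega'_n\}}$ and the left shift $T:\Sigma\to\Sigma$. Let $X$ be a non-empty compact metric space. For $\omega\in\Sigma$ let $F_\omega:X\to X$ be an $\alpha$-Hölder homeomorphism (with $\alpha>0$ independent of $\omega$) such that $\omega\mapsto F_\omega$ is Hölder continuous for the uniform distance. Let $\{\phi_t\}_{t\in X}$ be an equi-Hölder family of functions $\phi_t:\Sigma\to\mathbb R$ (common exponent and constant) such that $t\mapsto\phi_t$ is Hölder continuous for the uniform norm. Put $$\widehat F(\omega,t)=(T\omega,F_\omega(t)),\qquad \widehat\phi(\omega,t)=\phi_t(\omega)\qquad((\omega,t)\in\Sigma\times X),$$ $$\widetilde\phi(\omega)=\limsup_{n\to\infty}\ \sup_{t\in X}\ \frac1n\sum_{k=0}^{n-1}\widehat\phi\big(\widehat F^k(\omega,t)\big)\qquad(\omega\in\Sigma),$$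 let $\pi:\Sigma\times X\to\Sigma$ be the projection, and let $h_\nu(T)$ denote the Kolmogorov–Sinai entropy of $T$ with respect to a $T$-invariant Borel probability measure $\nu$. Then $\widetilde\phi$ is integrable with respect to every ergodic $T$-invariant Borel probability measure, and $$\max\Big\{h_{\widehat\nu\circ\pi^{-1}}(T)+\int\widehat\phi\,d\widehat\nu\ :\ \widehat\nu\text{ an ergodic }\widehat F\text{-invariant Borel probability on }\Sigma\times X\Big\}$$ $$=\ \max\Big\{h_{\nu}(T)+\int\widetilde\phi\,d\nu\ :\ \nu\text{ an ergodic }T\text{-invariant Borel probability on }\Sigma\Big\},$$ where both maxima are attained and their common value is a real number. -/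

import Mathlib

open MeasureTheory Filter
open scoped NNReal

noncomputable section

/-- The one-sided topological Markov shift over the alphabet `S` with transition relation `A`:
all sequences of letters whose consecutive letters are admissible transitions. -/
def MarkovShift {S : Type*} (A : S → S → Prop) : Type _ :=
  {ω : ℕ → S // ∀ n, A (ω n) (ω (n + 1))}

namespace MarkovShift

variable {S : Type*} {A : S → S → Prop}

/-- The usual metric `d(ω, ω') = (1/2) ^ min {n | ωₙ ≠ ω'ₙ}` on the shift space. -/
instance instMetricSpace : MetricSpace (MarkovShift A) :=
  letI : TopologicalSpace S := ⊥
  haveI : DiscreteTopology S := ⟨rfl⟩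
  letI : MetricSpace (ℕ → S) := PiNat.metricSpace
  inferInstanceAs (MetricSpace {ω : ℕ → S // ∀ n, A (ω n) (ω (n + 1))})

instance instMeasurableSpace : MeasurableSpace (MarkovShift A) := borel _

instance instBorelSpace : BorelSpace (MarkovShift A) := ⟨rfl⟩

/-- The left shift. -/
def shift (ω : MarkovShift A) : MarkovShift A :=
  ⟨fun n => ω.1 (n + 1), fun n => ω.2 (n + 1)⟩

end MarkovShift

section Entropy

variable {Ω : Type*} [MeasurableSpace Ω]

/-- Shannon entropy `H_μ(ξ) = -∑ₐ μ(ξ = a) log μ(ξ = a)` of the finite partition of `Ω` into the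
level sets of `ξ`. -/
def partitionEntropy {ι : Type*} [Fintype ι] (μ : Measure Ω) (ξ : Ω → ι) : ℝ :=
  ∑ a, Real.negMulLog (μ.real (ξ ⁻¹' {a}))

/-- The itinerary map whose level sets are the atoms of `⋁_{i < n} T⁻ⁱ ξ`. -/
def itinerary {ι : Type*} (T : Ω → Ω) (ξ : Ω → ι) (n : ℕ) (x : Ω) : Fin n → ι :=
  fun i => ξ (T^[i] x)

/-- Entropy of `T` with respect to a finite partition: the linear growth rate of
`H_μ(⋁_{i < n} T⁻ⁱ ξ)`. -/
def entropyOfPartition {k : ℕ} (T : Ω → Ω) (μ : Measure Ω) (ξ : Ω → Fin k) : EReal :=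
  limsup (fun n : ℕ => ((partitionEntropy μ (itinerary T ξ n) / n : ℝ) : EReal)) atTop

/-- Kolmogorov–Sinai entropy `h_μ(T)`: the supremum over all finite measurable partitions. -/
def measureEntropy (T : Ω → Ω) (μ : Measure Ω) : EReal :=
  ⨆ (k : ℕ) (ξ : Ω → Fin k) (_ : Measurable ξ), entropyOfPartition T μ ξ

end Entropy

section SkewProduct

variable {S X : Type*} {A : S → S → Prop}

/-- The skew product `(ω, t) ↦ (Tω, F_ω(t))`. -/
def skewProduct (F : MarkovShift A → X → X) (p : MarkovShift A × X) : MarkovShift A × X :=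
  (p.1.shift, F p.1 p.2)

/-- The function `(ω, t) ↦ φ_t(ω)` on the product space. -/
def jointPotential (φ : X → MarkovShift A → ℝ) (p : MarkovShift A × X) : ℝ :=
  φ p.2 p.1

/-- The maximal asymptotic instability potential: the upper limit in `n` of the suprema over `t`
of the Birkhoff averages of the potential along the orbit of `(ω, t)`. -/
def maxInstability (F : MarkovShift A → X → X) (φ : X → MarkovShift A → ℝ)
    (ω : MarkovShift A) : ℝ :=
  limsup (fun n : ℕ => ⨆ t : X,
    birkhoffAverage ℝ (skewProduct F) (jointPotential φ) n (ω, t)) atTop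

end SkewProduct

end

/-! Both maxima come from one ergodic measure on the product. The Hölder conditions make the skew
product and the joint potential continuous on a compact space. On the base, the partition by the
initial letter is a generator, so the entropy of an invariant measure is its `entropyRate` for
`head` (`measureEntropy_eq_entropyRate`). This is an infimum of weakly continuous functions, since
cylinders are clopen, hence upper semicontinuous; it is also convex on invariant measures. The
entropy of the projection plus the integral of the potential therefore attains its maximum over all
invariant measures, and it does so at an ergodic measure `μ`, an extreme point of the set of
maximizers (`exists_ergodic_isMaxOn`).

Two inequalities compare the product with the base. If `μ` is ergodic, the ergodic theorem bounds
its integral of the potential by the integral of `maxInstability` against the projection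
(`integral_jointPotential_le`). Conversely, an ergodic `ν` on the base has an invariant lift,
possibly not ergodic, whose integral of the potential is at least that of `maxInstability` against
`ν` (`exists_invariant_lift`). The lift comes from Hahn–Banach and Riesz, applied to the sublinear
functional that integrates fibrewise suprema against `ν`. As the lift projects to `ν`, the entropy
term is unchanged, and the maximum over all invariant measures bounds the base functional at `ν`.
The projection of the maximizing `μ` is ergodic and attains that bound. -/

set_option linter.unusedSectionVars false

noncomputable section

/-! ### Shannon entropy of finite partitions. -/

section PartitionEntropy

variable {Ω : Type*} [MeasurableSpace Ω] {ι κ τ : Type*} [Fintype ι] [Fintype κ] [Fintype τ]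

theorem negMulLog_add_le {x y : ℝ} (hx : 0 ≤ x) (hy : 0 ≤ y) :
    Real.negMulLog (x + y) ≤ Real.negMulLog x + Real.negMulLog y := by
  rcases hx.eq_or_lt with rfl | hx
  · simp
  rcases hy.eq_or_lt with rfl | hy
  · simp
  have h1 := Real.log_le_log hx (by linarith : x ≤ x + y)
  have h2 := Real.log_le_log hy (by linarith : y ≤ x + y)
  simp only [Real.negMulLog]
  nlinarith

theorem negMulLog_sum_le {s : Finset ι} {p : ι → ℝ} (hp : ∀ i, 0 ≤ p i) :
    Real.negMulLog (∑ i ∈ s, p i) ≤ ∑ i ∈ s, Real.negMulLog (p i) := by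
  classical
  induction s using Finset.induction_on with
  | empty => simp
  | insert a s ha ih =>
    rw [Finset.sum_insert ha, Finset.sum_insert ha]
    exact (negMulLog_add_le (hp a) (Finset.sum_nonneg fun i _ => hp i)).trans (by gcongr)

/-- A finite partition, given by a labelling, has measurable cells. -/
def MeasurableCells (ξ : Ω → ι) : Prop := ∀ a, MeasurableSet (ξ ⁻¹' {a})

theorem MeasurableCells.preimage {ξ : Ω → ι} (h : MeasurableCells ξ) (s : Set ι) :
    MeasurableSet (ξ ⁻¹' s) := by
  have : ξ ⁻¹' s = ⋃ a ∈ s, ξ ⁻¹' {a} := by ext; simp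
  rw [this]
  exact MeasurableSet.biUnion s.to_countable fun a _ => h a

theorem MeasurableCells.comp {ξ : Ω → ι} (h : MeasurableCells ξ) (f : ι → κ) :
    MeasurableCells (fun x => f (ξ x)) := fun a => h.preimage (f ⁻¹' {a})

theorem MeasurableCells.pair {ξ : Ω → ι} {η : Ω → κ} (h : MeasurableCells ξ)
    (h' : MeasurableCells η) : MeasurableCells (fun x => (ξ x, η x)) := by
  rintro ⟨a, b⟩
  have : (fun x => (ξ x, η x)) ⁻¹' {(a, b)} = ξ ⁻¹' {a} ∩ η ⁻¹' {b} := by ext; simp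
  rw [this]
  exact (h a).inter (h' b)

theorem MeasurableCells.comp_measurable {ξ : Ω → ι} (h : MeasurableCells ξ) {T : Ω → Ω}
    (hT : Measurable T) : MeasurableCells (fun x => ξ (T x)) := fun a => hT (h a)

theorem MeasurableCells.itinerary {ξ : Ω → ι} (h : MeasurableCells ξ) {T : Ω → Ω}
    (hT : Measurable T) (n : ℕ) : MeasurableCells (itinerary T ξ n) := by
  intro w
  have : _root_.itinerary T ξ n ⁻¹' {w} = ⋂ i : Fin n, (T^[i]) ⁻¹' (ξ ⁻¹' {w i}) := by
    ext; simp [_root_.itinerary, funext_iff]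
  rw [this]
  exact MeasurableSet.iInter fun i => (hT.iterate i) (h _)

variable (μ : Measure Ω)

theorem measureReal_preimage_eq_sum [IsFiniteMeasure μ] [DecidableEq κ] {ξ : Ω → ι} (h : MeasurableCells ξ)
    (f : ι → κ) (b : κ) :
    μ.real ((fun x => f (ξ x)) ⁻¹' {b}) =
      ∑ a ∈ Finset.univ.filter (fun a => f a = b), μ.real (ξ ⁻¹' {a}) := by
  have : (fun x => f (ξ x)) ⁻¹' {b} =
      ⋃ a ∈ Finset.univ.filter (fun a => f a = b), ξ ⁻¹' {a} := by ext; simp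
  rw [this, measureReal_biUnion_finset _ (fun a _ => h a)]
  intro a _ b _ hab
  exact Set.disjoint_left.2 fun x hx hx' => hab (hx.symm.trans hx')

theorem measureReal_preimage_eq_sum_pair [IsFiniteMeasure μ] {ξ : Ω → ι} {η : Ω → κ}
    (hξ : MeasurableCells ξ) (hη : MeasurableCells η) (b : κ) :
    μ.real (η ⁻¹' {b}) = ∑ a, μ.real ((fun x => (ξ x, η x)) ⁻¹' {(a, b)}) := by
  classical
  rw [measureReal_preimage_eq_sum μ (hξ.pair hη) Prod.snd b, Finset.sum_filter,
    Fintype.sum_prod_type]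
  simp

theorem sum_measureReal_preimage [IsProbabilityMeasure μ] {ξ : Ω → ι} (h : MeasurableCells ξ) :
    ∑ a, μ.real (ξ ⁻¹' {a}) = 1 := by
  have := measureReal_preimage_eq_sum μ h (fun _ => ()) ()
  simpa using this.symm

theorem partitionEntropy_nonneg [IsProbabilityMeasure μ] (ξ : Ω → ι) :
    0 ≤ partitionEntropy μ ξ :=
  Finset.sum_nonneg fun _ _ => Real.negMulLog_nonneg measureReal_nonneg measureReal_le_one

theorem partitionEntropy_comp_le [IsFiniteMeasure μ] {ξ : Ω → ι} (h : MeasurableCells ξ)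
    (f : ι → κ) : partitionEntropy μ (fun x => f (ξ x)) ≤ partitionEntropy μ ξ := by
  classical
  unfold partitionEntropy
  rw [← Finset.sum_fiberwise (s := Finset.univ) (g := f) (f := fun a => Real.negMulLog (μ.real (ξ ⁻¹' {a})))]
  refine Finset.sum_le_sum fun b _ => ?_
  rw [measureReal_preimage_eq_sum μ h]
  exact negMulLog_sum_le fun _ => measureReal_nonneg

theorem partitionEntropy_comp_measurePreserving {T : Ω → Ω} (hT : MeasurePreserving T μ μ)
    {ξ : Ω → ι} (h : MeasurableCells ξ) :
    partitionEntropy μ (fun x => ξ (T x)) = partitionEntropy μ ξ := by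
  unfold partitionEntropy
  refine Finset.sum_congr rfl fun a _ => ?_
  congr 1
  exact hT.measureReal_preimage (h a).nullMeasurableSet

/-- This is `log x ≤ x - 1` at `x = q r / (s p)`, multiplied by `p`. The case `p = 0` is separate
and only needs `q r / s ≥ 0`. -/
theorem negMulLog_submodular_aux {p q r s : ℝ} (hp : 0 ≤ p) (hq : p ≤ q) (hr : p ≤ r)
    (hs : q ≤ s) :
    -(p * Real.log p) - p * Real.log s + p * Real.log q + p * Real.log r ≤ q * r / s - p := by
  rcases hp.eq_or_lt with rfl | hp
  · simp only [zero_mul]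
    have := div_nonneg (mul_nonneg hq hr) (hq.trans hs)
    linarith
  have hq' := hp.trans_le hq
  have hr' := hp.trans_le hr
  have hs' := hq'.trans_le hs
  have := Real.log_le_sub_one_of_pos (x := q * r / (s * p)) (by positivity)
  rw [Real.log_div (by positivity) (by positivity), Real.log_mul hq'.ne' hr'.ne',
    Real.log_mul hs'.ne' hp.ne'] at this
  have h2 := mul_le_mul_of_nonneg_left this hp.le
  have h3 : p * (q * r / (s * p) - 1) = q * r / s - p := by field_simp
  rw [h3] at h2
  linarith

/-- Conditional mutual information is nonnegative: the termwise bounds `q r / s - p` sum, for each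
cell of `ζ`, to `s * s / s - s = 0`. All later rules for conditional entropy follow from this and
from monotonicity under relabelling. -/
theorem partitionEntropy_submodular [IsProbabilityMeasure μ] {ξ : Ω → ι} {η : Ω → κ} {ζ : Ω → τ}
    (hξ : MeasurableCells ξ) (hη : MeasurableCells η) (hζ : MeasurableCells ζ) :
    partitionEntropy μ (fun x => ((ξ x, η x), ζ x)) + partitionEntropy μ ζ ≤
      partitionEntropy μ (fun x => (ξ x, ζ x)) + partitionEntropy μ (fun x => (η x, ζ x)) := by
  classical
  set p : ι → κ → τ → ℝ := fun a b c => μ.real ((fun x => ((ξ x, η x), ζ x)) ⁻¹' {((a, b), c)})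
    with hp
  set q : ι → τ → ℝ := fun a c => μ.real ((fun x => (ξ x, ζ x)) ⁻¹' {(a, c)}) with hq
  set r : κ → τ → ℝ := fun b c => μ.real ((fun x => (η x, ζ x)) ⁻¹' {(b, c)}) with hr
  set s : τ → ℝ := fun c => μ.real (ζ ⁻¹' {c}) with hs
  have hM := (hξ.pair hη).pair hζ
  have hp0 : ∀ a b c, 0 ≤ p a b c := fun _ _ _ => measureReal_nonneg
  have hq0 : ∀ a c, 0 ≤ q a c := fun _ _ => measureReal_nonneg
  have hr0 : ∀ a c, 0 ≤ r a c := fun _ _ => measureReal_nonneg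
  have e1 : ∀ a c, q a c = ∑ b, p a b c := by
    intro a c
    rw [hq]; dsimp only
    rw [measureReal_preimage_eq_sum_pair μ hη (hξ.pair hζ) (a, c)]
    refine Finset.sum_congr rfl fun b _ => ?_
    congr 1
    ext; simp; tauto
  have e2 : ∀ b c, r b c = ∑ a, p a b c := by
    intro b c
    rw [hr]; dsimp only
    rw [measureReal_preimage_eq_sum_pair μ hξ (hη.pair hζ) (b, c)]
    refine Finset.sum_congr rfl fun b _ => ?_
    congr 1
    ext; simp; tauto
  have e3 : ∀ c, s c = ∑ a, q a c := fun c => measureReal_preimage_eq_sum_pair μ hξ hζ c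
  have e4 : ∀ c, s c = ∑ b, r b c := fun c => measureReal_preimage_eq_sum_pair μ hη hζ c
  have key : ∀ c, ∑ a, ∑ b, (-(p a b c * Real.log (p a b c)) - p a b c * Real.log (s c)
      + p a b c * Real.log (q a c) + p a b c * Real.log (r b c)) ≤ 0 := by
    intro c
    calc _ ≤ ∑ a, ∑ b, (q a c * r b c / s c - p a b c) := by
          refine Finset.sum_le_sum fun a _ => Finset.sum_le_sum fun b _ =>
            negMulLog_submodular_aux (hp0 a b c) ?_ ?_ ?_
          · rw [e1]
            exact Finset.single_le_sum (f := fun b => p a b c) (fun b _ => hp0 a b c)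
              (Finset.mem_univ b)
          · rw [e2]
            exact Finset.single_le_sum (f := fun a => p a b c) (fun a _ => hp0 a b c)
              (Finset.mem_univ a)
          · rw [e3]
            exact Finset.single_le_sum (f := fun a => q a c) (fun a _ => hq0 a c)
              (Finset.mem_univ a)
      _ = s c * s c / s c - s c := by
          simp_rw [Finset.sum_sub_distrib, ← e1, ← e3, ← Finset.sum_div, ← Finset.mul_sum,
            ← e4, ← Finset.sum_mul, ← e3]
      _ ≤ 0 := by rw [mul_self_div_self, sub_self]
  have tot := Finset.sum_le_sum (s := Finset.univ) fun c _ => key c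
  have f1 : partitionEntropy μ (fun x => ((ξ x, η x), ζ x)) =
      ∑ c, ∑ a, ∑ b, -(p a b c * Real.log (p a b c)) := by
    unfold partitionEntropy
    rw [Fintype.sum_prod_type, Finset.sum_comm]
    refine Finset.sum_congr rfl fun c _ => ?_
    rw [Fintype.sum_prod_type]
    simp [Real.negMulLog, hp]
  have f2 : partitionEntropy μ ζ = - ∑ c, ∑ a, ∑ b, p a b c * Real.log (s c) := by
    unfold partitionEntropy
    rw [← Finset.sum_neg_distrib]
    refine Finset.sum_congr rfl fun c _ => ?_
    simp_rw [← Finset.sum_mul, ← e1, ← e3]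
    simp [Real.negMulLog, hs]
  have f3 : partitionEntropy μ (fun x => (ξ x, ζ x)) =
      - ∑ c, ∑ a, ∑ b, p a b c * Real.log (q a c) := by
    unfold partitionEntropy
    rw [Fintype.sum_prod_type, Finset.sum_comm, ← Finset.sum_neg_distrib]
    refine Finset.sum_congr rfl fun c _ => ?_
    simp_rw [← Finset.sum_mul, ← e1]
    simp [Real.negMulLog, hq]
  have f4 : partitionEntropy μ (fun x => (η x, ζ x)) =
      - ∑ c, ∑ a, ∑ b, p a b c * Real.log (r b c) := by
    unfold partitionEntropy
    rw [Fintype.sum_prod_type, Finset.sum_comm, ← Finset.sum_neg_distrib]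
    refine Finset.sum_congr rfl fun c _ => ?_
    rw [Finset.sum_comm]
    simp_rw [← Finset.sum_mul, ← e2]
    simp [Real.negMulLog, hr]
  simp only [Finset.sum_add_distrib, Finset.sum_sub_distrib, Finset.sum_const_zero] at tot
  rw [f1, f2, f3, f4]
  linarith

/-- The conditional entropy `H(ξ | ζ)`. -/
def condPartitionEntropy (ξ : Ω → ι) (ζ : Ω → τ) : ℝ :=
  partitionEntropy μ (fun x => (ξ x, ζ x)) - partitionEntropy μ ζ

theorem condPartitionEntropy_pair_le [IsProbabilityMeasure μ] {ξ : Ω → ι} {η : Ω → κ} {ζ : Ω → τ}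
    (hξ : MeasurableCells ξ) (hη : MeasurableCells η) (hζ : MeasurableCells ζ) :
    condPartitionEntropy μ (fun x => (ξ x, η x)) ζ ≤
      condPartitionEntropy μ ξ ζ + condPartitionEntropy μ η ζ := by
  have := partitionEntropy_submodular μ hξ hη hζ
  unfold condPartitionEntropy
  linarith

theorem condPartitionEntropy_comp_left_le [IsProbabilityMeasure μ] {ξ : Ω → ι} {ζ : Ω → τ}
    (hξ : MeasurableCells ξ) (hζ : MeasurableCells ζ) (f : ι → κ) :
    condPartitionEntropy μ (fun x => f (ξ x)) ζ ≤ condPartitionEntropy μ ξ ζ := by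
  have := partitionEntropy_comp_le μ (hξ.pair hζ) (fun x => (f x.1, x.2))
  unfold condPartitionEntropy
  linarith

theorem condPartitionEntropy_le_comp_right [IsProbabilityMeasure μ] {ξ : Ω → ι} {ζ : Ω → τ}
    (hξ : MeasurableCells ξ) (hζ : MeasurableCells ζ) (f : τ → κ) :
    condPartitionEntropy μ ξ ζ ≤ condPartitionEntropy μ ξ (fun x => f (ζ x)) := by
  have h1 := partitionEntropy_submodular μ hξ hζ (hζ.comp f)
  have h2 := partitionEntropy_comp_le μ hζ (fun c => (c, f c))
  have h3 := partitionEntropy_comp_le μ ((hξ.pair hζ).pair (hζ.comp f)) (fun c => c.1)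
  unfold condPartitionEntropy
  linarith

theorem partitionEntropy_pair_le [IsProbabilityMeasure μ] {ξ : Ω → ι} {η : Ω → κ}
    (hξ : MeasurableCells ξ) (hη : MeasurableCells η) :
    partitionEntropy μ (fun x => (ξ x, η x)) ≤ partitionEntropy μ ξ + partitionEntropy μ η := by
  have hu : MeasurableCells (fun _ : Ω => ()) := fun _ => by simp
  have h1 := partitionEntropy_submodular μ hξ hη hu
  have h2 := partitionEntropy_comp_le μ hξ (fun c => (c, ()))
  have h3 := partitionEntropy_comp_le μ hη (fun c => (c, ()))
  have h4 := partitionEntropy_comp_le μ ((hξ.pair hη).pair hu) (fun c => c.1)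
  have h5 := partitionEntropy_nonneg μ (fun _ : Ω => ())
  linarith

theorem condPartitionEntropy_self [IsProbabilityMeasure μ] {ξ : Ω → ι} (hξ : MeasurableCells ξ) :
    condPartitionEntropy μ ξ ξ = 0 := by
  have h1 := partitionEntropy_comp_le μ hξ (fun c => (c, c))
  have h2 := partitionEntropy_comp_le μ (hξ.pair hξ) (fun c => c.1)
  unfold condPartitionEntropy
  linarith

theorem condPartitionEntropy_itinerary_le [IsProbabilityMeasure μ] {T : Ω → Ω} (hT : Measurable T)
    {ξ : Ω → ι} {ζ : Ω → τ} (hξ : MeasurableCells ξ) (hζ : MeasurableCells ζ) (n : ℕ) :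
    condPartitionEntropy μ (itinerary T ξ n) ζ ≤
      ∑ i ∈ Finset.range n, condPartitionEntropy μ (fun x => ξ (T^[i] x)) ζ := by
  induction n with
  | zero =>
    have h := partitionEntropy_comp_le μ hζ (fun c => ((fun i => i.elim0 : Fin 0 → ι), c))
    have : (fun x => (itinerary T ξ 0 x, ζ x)) = fun x => ((fun i => i.elim0 : Fin 0 → ι), ζ x) := by
      funext x
      exact Prod.ext (Subsingleton.elim _ _) rfl
    simp only [condPartitionEntropy, this, Finset.range_zero, Finset.sum_empty]
    linarith
  | succ n ih =>
    rw [Finset.sum_range_succ]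
    have h1 := condPartitionEntropy_pair_le μ (hξ.itinerary hT n)
      (hξ.comp_measurable (hT.iterate n)) hζ
    have h2 := condPartitionEntropy_comp_left_le μ
      ((hξ.itinerary hT n).pair (hξ.comp_measurable (hT.iterate n))) hζ
      (fun c => (Fin.snoc c.1 c.2 : Fin (n + 1) → ι))
    have : (fun x => (Fin.snoc (itinerary T ξ n x) (ξ (T^[n] x)) : Fin (n + 1) → ι)) =
        itinerary T ξ (n + 1) := by
      funext x i
      refine Fin.lastCases ?_ (fun j => ?_) i <;> simp [itinerary]
    dsimp only at h2
    rw [this] at h2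
    linarith

/-- Given `n + m` steps of the `ξ`-itinerary, each `η ∘ T^i` with `i < n` sees the window of length
`m` starting at `i`; by invariance its conditional entropy is at most that of `η` given `m` steps.
-/
theorem partitionEntropy_itinerary_le [IsProbabilityMeasure μ] {T : Ω → Ω}
    (hT : MeasurePreserving T μ μ) {ξ : Ω → ι} {η : Ω → κ} (hξ : MeasurableCells ξ)
    (hη : MeasurableCells η) (n m : ℕ) :
    partitionEntropy μ (itinerary T η n) ≤ partitionEntropy μ (itinerary T ξ (n + m)) +
      n * condPartitionEntropy μ η (itinerary T ξ m) := by
  have hTm := hT.measurable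
  have h1 := condPartitionEntropy_itinerary_le μ hTm hη (hξ.itinerary hTm (n + m)) n
  have h2 := partitionEntropy_comp_le μ ((hη.itinerary hTm n).pair (hξ.itinerary hTm (n + m)))
    Prod.fst
  have h3 : ∀ i ∈ Finset.range n, condPartitionEntropy μ (fun x => η (T^[i] x))
      (itinerary T ξ (n + m)) ≤ condPartitionEntropy μ η (itinerary T ξ m) := by
    intro i hi
    rw [Finset.mem_range] at hi
    have h := condPartitionEntropy_le_comp_right μ (hη.comp_measurable (hTm.iterate i))
      (hξ.itinerary hTm (n + m)) (fun w (j : Fin m) => w ⟨i + j, by omega⟩)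
    refine h.trans_eq ?_
    have : (fun x (j : Fin m) => itinerary T ξ (n + m) x ⟨i + j, by omega⟩) =
        fun x => itinerary T ξ m (T^[i] x) := by
      funext x j
      simp only [itinerary]
      rw [← Function.iterate_add_apply, add_comm]
    unfold condPartitionEntropy
    rw [this, partitionEntropy_comp_measurePreserving μ (hT.iterate i) (hξ.itinerary hTm m),
      partitionEntropy_comp_measurePreserving μ (hT.iterate i) (hη.pair (hξ.itinerary hTm m))]
  have h4 := Finset.sum_le_sum h3
  simp only [Finset.sum_const, Finset.card_range, nsmul_eq_mul] at h4
  unfold condPartitionEntropy at h1 h4 ⊢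
  linarith

theorem subadditive_partitionEntropy_itinerary [IsProbabilityMeasure μ] {T : Ω → Ω}
    (hT : MeasurePreserving T μ μ) {ξ : Ω → ι} (hξ : MeasurableCells ξ) :
    Subadditive fun n => partitionEntropy μ (itinerary T ξ n) := by
  intro m n
  have hTm := hT.measurable
  have h1 := partitionEntropy_pair_le μ (hξ.itinerary hTm m)
    ((hξ.itinerary hTm n).comp_measurable (hTm.iterate m))
  rw [partitionEntropy_comp_measurePreserving μ (hT.iterate m) (hξ.itinerary hTm n)] at h1
  have h2 := partitionEntropy_comp_le μ ((hξ.itinerary hTm m).pair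
    ((hξ.itinerary hTm n).comp_measurable (hTm.iterate m)))
    (fun c => (Fin.append c.1 c.2 : Fin (m + n) → ι))
  have : (fun x => (Fin.append (itinerary T ξ m x) (itinerary T ξ n (T^[m] x)) : Fin (m + n) → ι)) =
      itinerary T ξ (m + n) := by
    funext x i
    refine Fin.addCases (fun j => ?_) (fun j => ?_) i
    · simp [itinerary]
    · simp only [itinerary, Fin.append_right, Fin.val_natAdd]
      rw [← Function.iterate_add_apply, add_comm]
  dsimp only at h2
  rw [this] at h2
  linarith

/-- The growth rate of the entropies of the iterated partitions, as an infimum. -/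
def entropyRate (T : Ω → Ω) (ξ : Ω → ι) : ℝ :=
  ⨅ n : ℕ, partitionEntropy μ (itinerary T ξ (n + 1)) / (n + 1)

theorem tendsto_entropyRate [IsProbabilityMeasure μ] {T : Ω → Ω}
    (hT : MeasurePreserving T μ μ) {ξ : Ω → ι} (hξ : MeasurableCells ξ) :
    Tendsto (fun n : ℕ => partitionEntropy μ (itinerary T ξ n) / n) atTop
      (nhds (entropyRate μ T ξ)) := by
  have hs := subadditive_partitionEntropy_itinerary μ hT hξ
  have hb : BddBelow (Set.range fun n : ℕ => partitionEntropy μ (itinerary T ξ n) / n) :=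
    ⟨0, by rintro _ ⟨n, rfl⟩; exact div_nonneg (partitionEntropy_nonneg μ _) n.cast_nonneg⟩
  have hl := hs.tendsto_lim hb
  convert hl using 2
  -- `Subadditive.lim` is an infimum over `n ≥ 1`; the shifted index in `entropyRate` runs through
  -- the same quotients.
  unfold entropyRate Subadditive.lim iInf
  congr 1
  ext y
  constructor
  · rintro ⟨n, rfl⟩
    exact ⟨n + 1, by simp, by push_cast; rfl⟩
  · rintro ⟨n, hn, rfl⟩
    obtain ⟨k, rfl⟩ := Nat.exists_eq_add_of_le' (Set.mem_Ici.1 hn)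
    exact ⟨k, by push_cast; rfl⟩

/-- The measures of the finitely many cells change by at most the measure of the disagreement set,
so by continuity of `negMulLog` the limit is `H(η | η) = 0`. -/
theorem tendsto_condPartitionEntropy_of_approx [IsProbabilityMeasure μ] {η : Ω → κ}
    (hη : MeasurableCells η) {ζ : ℕ → Ω → κ} (hζ : ∀ j, MeasurableCells (ζ j))
    (hlim : Tendsto (fun j => μ.real {x | η x ≠ ζ j x}) atTop (nhds 0)) :
    Tendsto (fun j => condPartitionEntropy μ η (ζ j)) atTop (nhds 0) := by
  have aux : ∀ (s t : Set Ω) (j : ℕ), MeasurableSet s → MeasurableSet t →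
      symmDiff s t ⊆ {x | η x ≠ ζ j x} →
      |μ.real s - μ.real t| ≤ μ.real {x | η x ≠ ζ j x} := fun s t j hs ht h =>
    (abs_measureReal_sub_le_measureReal_symmDiff hs.nullMeasurableSet ht.nullMeasurableSet).trans
      (measureReal_mono h)
  have lim : ∀ (s : ℕ → Set Ω) (t : Set Ω), (∀ j, MeasurableSet (s j)) → MeasurableSet t →
      (∀ j, symmDiff (s j) t ⊆ {x | η x ≠ ζ j x}) →
      Tendsto (fun j => Real.negMulLog (μ.real (s j))) atTop (nhds (Real.negMulLog (μ.real t))) := by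
    intro s t hs ht h
    refine (Real.continuous_negMulLog.tendsto _).comp ?_
    rw [tendsto_iff_norm_sub_tendsto_zero]
    exact squeeze_zero (fun _ => norm_nonneg _) (fun j => aux _ _ j (hs j) ht (h j)) hlim
  have h1 : Tendsto (fun j => partitionEntropy μ (fun x => (η x, ζ j x))) atTop
      (nhds (partitionEntropy μ (fun x => (η x, η x)))) := by
    refine tendsto_finsetSum _ fun a _ => lim _ _ (fun j => (hη.pair (hζ j)) a) ((hη.pair hη) a) ?_
    rintro j x (⟨hx, hx'⟩ | ⟨hx, hx'⟩) he <;> exact hx' (by simpa [← he] using hx)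
  have h2 : Tendsto (fun j => partitionEntropy μ (ζ j)) atTop (nhds (partitionEntropy μ η)) := by
    refine tendsto_finsetSum _ fun a _ => lim _ _ (fun j => hζ j a) (hη a) ?_
    rintro j x (⟨hx, hx'⟩ | ⟨hx, hx'⟩) he <;> exact hx' (by simpa [he] using hx)
  have := h1.sub h2
  have h0 := condPartitionEntropy_self μ hη
  unfold condPartitionEntropy at h0 ⊢
  rwa [h0] at this

end PartitionEntropy

/-! ### Generators, and convexity of the entropy rate. -/

section Generator

variable {Ω : Type*} [mΩ : MeasurableSpace Ω] {ι κ : Type*} [Fintype ι] [Fintype κ]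

/-- The algebra of sets determined by finitely many steps of the itinerary. -/
def itinerarySets (T : Ω → Ω) (ξ : Ω → ι) : Set (Set Ω) :=
  {B | ∃ (m : ℕ) (s : Set (Fin m → ι)), B = itinerary T ξ m ⁻¹' s}

theorem itinerary_preimage_lift (T : Ω → Ω) (ξ : Ω → ι) {m n : ℕ} (h : m ≤ n)
    (s : Set (Fin m → ι)) :
    itinerary T ξ m ⁻¹' s =
      itinerary T ξ n ⁻¹' ((fun w (i : Fin m) => w (Fin.castLE h i)) ⁻¹' s) := rfl

theorem isSetAlgebra_itinerarySets (T : Ω → Ω) (ξ : Ω → ι) :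
    IsSetAlgebra (itinerarySets T ξ) where
  empty_mem := ⟨0, ∅, rfl⟩
  compl_mem := by
    rintro _ ⟨m, s, rfl⟩
    exact ⟨m, sᶜ, rfl⟩
  union_mem := by
    rintro _ _ ⟨m, s, rfl⟩ ⟨n, t, rfl⟩
    rw [itinerary_preimage_lift T ξ (le_max_left m n), itinerary_preimage_lift T ξ (le_max_right m n) t]
    exact ⟨max m n, _, Set.preimage_union.symm⟩

variable (μ : Measure Ω)

theorem exists_itinerary_approx [IsProbabilityMeasure μ] {T : Ω → Ω} {ξ : Ω → ι}
    (hgen : mΩ = MeasurableSpace.generateFrom (itinerarySets T ξ)) {η : Ω → κ}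
    (hη : MeasurableCells η) {ε : ℝ} (hε : 0 < ε) :
    ∃ (m : ℕ) (g : (Fin m → ι) → κ), μ.real {x | η x ≠ g (itinerary T ξ m x)} < ε := by
  classical
  have : Nonempty κ := ⟨η (nonempty_of_isProbabilityMeasure μ).some⟩
  have hd := Measure.MeasureDense.of_generateFrom_isSetAlgebra_finite (μ := μ)
    (isSetAlgebra_itinerarySets T ξ) hgen
  have hc : (0 : ℝ) < Fintype.card κ := by exact_mod_cast Fintype.card_pos
  have hex : ∀ a : κ, ∃ (m : ℕ) (s : Set (Fin m → ι)),
      μ.real (symmDiff (η ⁻¹' {a}) (itinerary T ξ m ⁻¹' s)) < ε / Fintype.card κ := by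
    intro a
    obtain ⟨t, ⟨m, s, rfl⟩, h⟩ := hd.approx (η ⁻¹' {a}) (hη a) (measure_ne_top _ _)
      (ε / Fintype.card κ) (by positivity)
    exact ⟨m, s, ENNReal.toReal_lt_of_lt_ofReal h⟩
  choose M s hs using hex
  let N := Finset.univ.sup M
  have hN : ∀ a, M a ≤ N := fun a => Finset.le_sup (Finset.mem_univ a)
  let s' : κ → Set (Fin N → ι) := fun a => (fun w (i : Fin (M a)) => w (Fin.castLE (hN a) i)) ⁻¹' s a
  -- Off the symmetric differences a word lies in exactly one `s' a`, with `a` the true label. The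
  -- arbitrary choices matter only on that small exceptional set.
  refine ⟨N, fun w => if h : ∃ a, w ∈ s' a then h.choose else Classical.arbitrary κ, ?_⟩
  have hsub : {x | η x ≠ (fun w => if h : ∃ a, w ∈ s' a then h.choose else Classical.arbitrary κ)
      (itinerary T ξ N x)} ⊆ ⋃ a, symmDiff (η ⁻¹' {a}) (itinerary T ξ (M a) ⁻¹' s a) := by
    intro x hx
    by_contra hcon
    have hiff : ∀ a, η x = a ↔ itinerary T ξ N x ∈ s' a := by
      intro a
      have h1 : x ∉ symmDiff (η ⁻¹' {a}) (itinerary T ξ (M a) ⁻¹' s a) := fun h =>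
        hcon (Set.mem_iUnion.2 ⟨a, h⟩)
      rw [Set.mem_symmDiff] at h1
      have h2 : x ∈ itinerary T ξ (M a) ⁻¹' s a ↔ itinerary T ξ N x ∈ s' a := Iff.rfl
      rw [h2] at h1
      have h3 : x ∈ η ⁻¹' {a} ↔ η x = a := Iff.rfl
      rw [h3] at h1
      tauto
    have hexi : ∃ a, itinerary T ξ N x ∈ s' a := ⟨η x, (hiff _).1 rfl⟩
    refine hx ?_
    simp only [dif_pos hexi]
    exact (hiff _).2 hexi.choose_spec
  refine (measureReal_mono hsub).trans_lt ((measureReal_iUnion_fintype_le _).trans_lt ?_)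
  calc _ < ∑ _a : κ, ε / Fintype.card κ :=
        Finset.sum_lt_sum_of_nonempty Finset.univ_nonempty fun a _ => hs a
    _ = ε := by
        rw [Finset.sum_const, Finset.card_univ, nsmul_eq_mul]
        field_simp

theorem entropyOfPartition_le_entropyRate [IsProbabilityMeasure μ] {T : Ω → Ω}
    (hT : MeasurePreserving T μ μ) {ξ : Ω → ι} (hξ : MeasurableCells ξ)
    (hgen : mΩ = MeasurableSpace.generateFrom (itinerarySets T ξ)) {k : ℕ} {η : Ω → Fin k}
    (hη : MeasurableCells η) : entropyOfPartition T μ η ≤ entropyRate μ T ξ := by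
  have hTm := hT.measurable
  refine EReal.le_of_forall_lt_iff_le.1 fun z hz => ?_
  rw [EReal.coe_lt_coe_iff] at hz
  have happ : ∀ j : ℕ, ∃ (m : ℕ) (g : (Fin m → ι) → Fin k),
      μ.real {x | η x ≠ g (itinerary T ξ m x)} < 1 / ((j : ℝ) + 1) := fun j =>
    exists_itinerary_approx μ hgen hη (by positivity)
  choose M g hg using happ
  have hlim := tendsto_condPartitionEntropy_of_approx μ hη
    (ζ := fun j x => g j (itinerary T ξ (M j) x)) (fun j => (hξ.itinerary hTm _).comp (g j))
    (squeeze_zero (fun _ => measureReal_nonneg) (fun j => (hg j).le)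
      tendsto_one_div_add_atTop_nhds_zero_nat)
  obtain ⟨j, hj⟩ := (hlim.eventually_lt_const (sub_pos.2 hz)).exists
  have hj' := (condPartitionEntropy_le_comp_right μ hη (hξ.itinerary hTm (M j)) (g j)).trans_lt hj
  set D := condPartitionEntropy μ η (itinerary T ξ (M j))
  set C := partitionEntropy μ (itinerary T ξ (M j))
  -- `C` pays for the `M j` extra steps and disappears after division by `n`; `D` is less than the
  -- gap `z - entropyRate μ T ξ`.
  have hl : Tendsto (fun n : ℕ => partitionEntropy μ (itinerary T ξ n) / n + C / n + D) atTop
      (nhds (entropyRate μ T ξ + 0 + D)) :=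
    ((tendsto_entropyRate μ hT hξ).add
      (tendsto_const_nhds.div_atTop tendsto_natCast_atTop_atTop)).add_const _
  have hev := hl.eventually_le_const (show entropyRate μ T ξ + 0 + D < z by linarith)
  refine limsup_le_of_le (h := ?_)
  filter_upwards [hev, eventually_gt_atTop 0] with n hn hn0
  rw [EReal.coe_le_coe_iff]
  refine le_trans ?_ hn
  have hn' : (0 : ℝ) < n := by exact_mod_cast hn0
  have h1 := partitionEntropy_itinerary_le μ hT hξ hη n (M j)
  have h2 := subadditive_partitionEntropy_itinerary μ hT hξ n (M j)
  rw [← add_div, div_add' _ _ _ hn'.ne']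
  gcongr
  linarith

/-- **Kolmogorov–Sinai generator theorem** for finite one-sided generators. -/
theorem measureEntropy_eq_entropyRate [IsProbabilityMeasure μ] {T : Ω → Ω}
    (hT : MeasurePreserving T μ μ) {ξ : Ω → ι} (hξ : MeasurableCells ξ)
    (hgen : mΩ = MeasurableSpace.generateFrom (itinerarySets T ξ)) :
    measureEntropy T μ = entropyRate μ T ξ := by
  apply le_antisymm
  · exact iSup_le fun k => iSup_le fun η => iSup_le fun hη =>
      entropyOfPartition_le_entropyRate μ hT hξ hgen fun a => hη (measurableSet_singleton a)
  -- The supremum in `measureEntropy` runs over labels in `Fin k`, so the cells of `ξ` are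
  -- renumbered.
  · let e := Fintype.equivFin ι
    have hξ' : MeasurableCells (fun x => e (ξ x)) := hξ.comp e
    have hm : Measurable (fun x => e (ξ x)) := fun s _ => hξ'.preimage s
    refine le_trans (le_of_eq ?_)
      (le_iSup_of_le (Fintype.card ι) (le_iSup_of_le (fun x => e (ξ x)) (le_iSup_of_le hm le_rfl)))
    unfold entropyOfPartition
    have heq : ∀ n, partitionEntropy μ (itinerary T (fun x => e (ξ x)) n) =
        partitionEntropy μ (itinerary T ξ n) := by
      intro n
      have h1 := partitionEntropy_comp_le μ (hξ.itinerary hT.measurable n)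
        (fun w i => e (w i))
      have h2 := partitionEntropy_comp_le μ (hξ'.itinerary hT.measurable n)
        (fun w i => e.symm (w i))
      simp only [itinerary, Equiv.symm_apply_apply] at h1 h2
      exact le_antisymm h1 h2
    simp_rw [heq]
    exact (((continuous_coe_real_ereal.tendsto _).comp (tendsto_entropyRate μ hT hξ)).limsup_eq).symm

/-- Subadditivity of `negMulLog` with its product rule. The error does not depend on the partition,
so it vanishes in the entropy rate. -/
theorem partitionEntropy_convexComb_le {μ₁ μ₂ : Measure Ω} [IsProbabilityMeasure μ₁]
    [IsProbabilityMeasure μ₂] {a b : ℝ≥0} {ξ : Ω → ι} (hξ : MeasurableCells ξ) :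
    partitionEntropy (a • μ₁ + b • μ₂) ξ ≤ a * partitionEntropy μ₁ ξ + b * partitionEntropy μ₂ ξ +
      (Real.negMulLog a + Real.negMulLog b) := by
  have h : ∀ i, Real.negMulLog ((a • μ₁ + b • μ₂).real (ξ ⁻¹' {i})) ≤
      (a * Real.negMulLog (μ₁.real (ξ ⁻¹' {i})) + b * Real.negMulLog (μ₂.real (ξ ⁻¹' {i}))) +
        (μ₁.real (ξ ⁻¹' {i}) * Real.negMulLog a + μ₂.real (ξ ⁻¹' {i}) * Real.negMulLog b) := by
    intro i
    rw [measureReal_add_apply, measureReal_nnreal_smul_apply, measureReal_nnreal_smul_apply]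
    refine (negMulLog_add_le (by positivity) (by positivity)).trans_eq ?_
    rw [Real.negMulLog_mul, Real.negMulLog_mul]
    ring
  refine (Finset.sum_le_sum fun i _ => h i).trans_eq ?_
  rw [Finset.sum_add_distrib, Finset.sum_add_distrib, Finset.sum_add_distrib, ← Finset.sum_mul,
    ← Finset.sum_mul, ← Finset.mul_sum, ← Finset.mul_sum, sum_measureReal_preimage μ₁ hξ,
    sum_measureReal_preimage μ₂ hξ]
  simp [partitionEntropy]

theorem entropyRate_convexComb_le {μ₁ μ₂ : Measure Ω} [IsProbabilityMeasure μ₁]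
    [IsProbabilityMeasure μ₂] {a b : ℝ≥0} (hab : a + b = 1) {T : Ω → Ω}
    (h₁ : MeasurePreserving T μ₁ μ₁) (h₂ : MeasurePreserving T μ₂ μ₂)
    {ξ : Ω → ι} (hξ : MeasurableCells ξ) :
    entropyRate (a • μ₁ + b • μ₂) T ξ ≤ a * entropyRate μ₁ T ξ + b * entropyRate μ₂ T ξ := by
  have hp : IsProbabilityMeasure (a • μ₁ + b • μ₂) := ⟨by
    simp only [Measure.coe_add, Pi.add_apply, Measure.coe_nnreal_smul_apply, measure_univ, mul_one]
    exact_mod_cast hab⟩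
  have h : MeasurePreserving T (a • μ₁ + b • μ₂) (a • μ₁ + b • μ₂) :=
    ⟨h₁.measurable, by
      rw [Measure.map_add _ _ h₁.measurable, Measure.map_smul, Measure.map_smul, h₁.map_eq,
        h₂.map_eq]⟩
  have hl := (((tendsto_entropyRate μ₁ h₁ hξ).const_mul (a : ℝ)).add
    ((tendsto_entropyRate μ₂ h₂ hξ).const_mul (b : ℝ))).add
    ((tendsto_const_nhds (x := Real.negMulLog a + Real.negMulLog b)).div_atTop
      tendsto_natCast_atTop_atTop)
  rw [add_zero] at hl
  refine le_of_tendsto_of_tendsto' (tendsto_entropyRate _ h hξ) hl fun n => ?_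
  have := partitionEntropy_convexComb_le (μ₁ := μ₁) (μ₂ := μ₂) (a := a) (b := b)
    (hξ.itinerary h₁.measurable n)
  refine (div_le_div_of_nonneg_right this n.cast_nonneg).trans_eq ?_
  ring

end Generator

/-! ### Topology and Borel structure of the Markov shift. -/

namespace MarkovShift

variable {S : Type*} {A : S → S → Prop}

theorem isInducing_val [t : TopologicalSpace S] [DiscreteTopology S] :
    Topology.IsInducing (fun ω : MarkovShift A => ω.1) := by
  constructor
  obtain rfl := DiscreteTopology.eq_bot (α := S)
  rfl

theorem isClopen_setOf_coord (n : ℕ) (s : Set S) : IsClopen {ω : MarkovShift A | ω.1 n ∈ s} := by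
  let : TopologicalSpace S := ⊥
  have : DiscreteTopology S := ⟨rfl⟩
  exact (isClopen_discrete s).preimage ((continuous_apply n).comp isInducing_val.continuous)

instance instCompactSpace [Finite S] : CompactSpace (MarkovShift A) := by
  let : TopologicalSpace S := ⊥
  have : DiscreteTopology S := ⟨rfl⟩
  have hc : IsClosed {ω : ℕ → S | ∀ n, A (ω n) (ω (n + 1))} := by
    rw [show {ω : ℕ → S | ∀ n, A (ω n) (ω (n + 1))} =
      ⋂ n, (fun ω : ℕ → S => (ω n, ω (n + 1))) ⁻¹' {p | A p.1 p.2} by ext; simp]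
    exact isClosed_iInter fun n => (isClosed_discrete _).preimage (by fun_prop)
  rw [← isCompact_univ_iff, isInducing_val.isCompact_iff]
  convert hc.isCompact
  ext ω
  exact ⟨by rintro ⟨x, -, rfl⟩; exact x.2, fun h => ⟨⟨ω, h⟩, trivial, rfl⟩⟩

theorem continuous_shift : Continuous (shift : MarkovShift A → MarkovShift A) := by
  let : TopologicalSpace S := ⊥
  have : DiscreteTopology S := ⟨rfl⟩
  have : Continuous fun ω : MarkovShift A => fun n => ω.1 (n + 1) :=
    continuous_pi fun n => (continuous_apply (n + 1)).comp isInducing_val.continuous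
  exact isInducing_val.continuous_iff.2 this

theorem iterate_shift_val (n k : ℕ) (ω : MarkovShift A) : (shift^[n] ω).1 k = ω.1 (k + n) := by
  induction n generalizing ω with
  | zero => rfl
  | succ n ih => rw [Function.iterate_succ_apply, ih]; rfl

/-- The labelling of the shift space by the initial letter. -/
def head (ω : MarkovShift A) : S := ω.1 0

theorem isClopen_itinerary_preimage (n : ℕ) (w : Fin n → S) :
    IsClopen (itinerary shift (head (A := A)) n ⁻¹' {w}) := by
  have : itinerary shift (head (A := A)) n ⁻¹' {w} =
      ⋂ i : Fin n, {ω : MarkovShift A | ω.1 i ∈ ({w i} : Set S)} := by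
    ext; simp [itinerary, funext_iff, head, iterate_shift_val]
  rw [this]
  exact isClopen_iInter_of_finite fun i => isClopen_setOf_coord _ _

theorem measurableCells_head : MeasurableCells (head : MarkovShift A → S) := fun a =>
  (isClopen_setOf_coord 0 {a}).isOpen.measurableSet

/-- The initial-letter partition generates: the Borel structure is pulled back from the product,
where coordinates generate it, and coordinate `n` is the last entry of an itinerary of length `n +
1`. -/
theorem measurableSpace_eq_generateFrom [Fintype S] :
    (instMeasurableSpace : MeasurableSpace (MarkovShift A)) =
      MeasurableSpace.generateFrom (itinerarySets shift head) := by
  apply le_antisymm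
  · let : TopologicalSpace S := ⊥
    have : DiscreteTopology S := ⟨rfl⟩
    let : MeasurableSpace S := ⊤
    have h1 : (instMeasurableSpace : MeasurableSpace (MarkovShift A)) =
        (borel (ℕ → S)).comap (fun ω => ω.1) := by
      rw [← borel_comap, ← isInducing_val.eq_induced]; rfl
    rw [h1, ← BorelSpace.measurable_eq (α := ℕ → S), ← measurable_iff_comap_le]
    let : MeasurableSpace (MarkovShift A) := MeasurableSpace.generateFrom (itinerarySets shift head)
    refine measurable_pi_iff.2 fun n t _ => MeasurableSpace.measurableSet_generateFrom ?_
    refine ⟨n + 1, {w | w (Fin.last n) ∈ t}, ?_⟩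
    ext ω
    simp [itinerary, head, iterate_shift_val]
  · refine MeasurableSpace.generateFrom_le ?_
    rintro _ ⟨m, s, rfl⟩
    exact (measurableCells_head.itinerary continuous_shift.measurable m).preimage s

end MarkovShift

/-! ### Maximal ergodic theorem and the upper half of Birkhoff's theorem. -/

section MaximalErgodic

variable {Ω : Type*} [MeasurableSpace Ω] {μ : Measure Ω}

/-- The maximum of the Birkhoff sums over all times up to `N`, including the time zero. -/
def maxBirkhoffSum (T : Ω → Ω) (g : Ω → ℝ) : ℕ → Ω → ℝ
  | 0, _ => 0
  | N + 1, x => max 0 (g x + maxBirkhoffSum T g N (T x))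

theorem maxBirkhoffSum_nonneg (T : Ω → Ω) (g : Ω → ℝ) (N : ℕ) (x : Ω) :
    0 ≤ maxBirkhoffSum T g N x := by
  cases N
  · exact le_rfl
  · exact le_max_left _ _

theorem maxBirkhoffSum_le_succ (T : Ω → Ω) (g : Ω → ℝ) (N : ℕ) (x : Ω) :
    maxBirkhoffSum T g N x ≤ maxBirkhoffSum T g (N + 1) x := by
  induction N generalizing x with
  | zero => exact maxBirkhoffSum_nonneg T g 1 x
  | succ N ih => exact max_le_max le_rfl (by have := ih (T x); linarith)

theorem birkhoffSum_le_maxBirkhoffSum (T : Ω → Ω) (g : Ω → ℝ) (N : ℕ) (x : Ω) :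
    birkhoffSum T g N x ≤ maxBirkhoffSum T g N x := by
  induction N generalizing x with
  | zero => simp [maxBirkhoffSum]
  | succ N ih =>
    rw [birkhoffSum_succ']
    exact le_max_of_le_right (by have := ih (T x); linarith)

theorem integrable_maxBirkhoffSum {T : Ω → Ω} (hT : MeasurePreserving T μ μ) {g : Ω → ℝ}
    (hgi : Integrable g μ) (N : ℕ) : Integrable (maxBirkhoffSum T g N) μ := by
  induction N with
  | zero => exact integrable_zero _ _ _
  | succ N ih => exact (integrable_zero _ _ _).sup (hgi.add (hT.integrable_comp_of_integrable ih))

theorem measurable_maxBirkhoffSum {T : Ω → Ω} (hT : Measurable T) {g : Ω → ℝ}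
    (hg : Measurable g) (N : ℕ) : Measurable (maxBirkhoffSum T g N) := by
  induction N with
  | zero => exact measurable_const
  | succ N ih => exact measurable_const.max (hg.add (ih.comp hT))

/-- A form of the **maximal ergodic theorem**. -/
theorem integral_nonneg_of_exists_birkhoffSum_pos {T : Ω → Ω} (hT : MeasurePreserving T μ μ)
    {g : Ω → ℝ} (hg : Measurable g) (hgi : Integrable g μ)
    (h : ∀ᵐ x ∂μ, ∃ n, 0 < birkhoffSum T g n x) : 0 ≤ ∫ x, g x ∂μ := by
  let E : ℕ → Set Ω := fun N => {x | 0 < maxBirkhoffSum T g N x}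
  have hE : ∀ N, MeasurableSet (E N) := fun N =>
    measurableSet_lt measurable_const (measurable_maxBirkhoffSum hT.measurable hg N)
  have hmono : Monotone E := monotone_nat_of_le_succ fun N x hx =>
    lt_of_lt_of_le hx (maxBirkhoffSum_le_succ T g N x)
  have hlim := tendsto_setIntegral_of_monotone hE hmono hgi.integrableOn
  have hU : ∫ x in ⋃ N, E N, g x ∂μ = ∫ x, g x ∂μ := by
    rw [Measure.restrict_eq_self_of_ae_mem]
    filter_upwards [h] with x ⟨n, hn⟩
    exact Set.mem_iUnion.2 ⟨n, lt_of_lt_of_le hn (birkhoffSum_le_maxBirkhoffSum T g n x)⟩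
  rw [hU] at hlim
  refine ge_of_tendsto' hlim fun N => ?_
  have hi := integrable_maxBirkhoffSum hT hgi N
  have hiT : Integrable (fun x => maxBirkhoffSum T g N (T x)) μ := hT.integrable_comp_of_integrable hi
  -- Where the maximum is positive, its recursion has the value `g x` plus the earlier maximum at `T
  -- x`; elsewhere it is zero. The left side has integral zero by invariance.
  have key : ∀ x, maxBirkhoffSum T g N x - maxBirkhoffSum T g N (T x) ≤ (E N).indicator g x := by
    intro x
    by_cases hx : x ∈ E N
    · rw [Set.indicator_of_mem hx]
      cases N with
      | zero => exact absurd (show (0 : ℝ) < 0 from hx) (lt_irrefl _)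
      | succ N =>
        have hx' : 0 < max 0 (g x + maxBirkhoffSum T g N (T x)) := hx
        have h1 : maxBirkhoffSum T g (N + 1) x = g x + maxBirkhoffSum T g N (T x) :=
          max_eq_right (by
            by_contra hc
            rw [max_eq_left (not_le.1 hc).le] at hx'
            exact lt_irrefl _ hx')
        have := maxBirkhoffSum_le_succ T g N (T x)
        linarith
    · rw [Set.indicator_of_notMem hx]
      have h0 : maxBirkhoffSum T g N x ≤ 0 := not_lt.1 hx
      have := maxBirkhoffSum_nonneg T g N (T x)
      linarith
  rw [← integral_indicator (hE N)]
  calc (0 : ℝ) = ∫ x, (maxBirkhoffSum T g N x - maxBirkhoffSum T g N (T x)) ∂μ := by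
        rw [integral_sub hi hiT]
        have : ∫ x, maxBirkhoffSum T g N (T x) ∂μ = ∫ x, maxBirkhoffSum T g N x ∂μ := by
          conv_rhs => rw [← hT.map_eq]
          rw [integral_map hT.measurable.aemeasurable]
          rw [hT.map_eq]
          exact hi.aestronglyMeasurable
        rw [this, sub_self]
    _ ≤ _ := integral_mono (hi.sub hiT) (hgi.indicator (hE N)) key

theorem abs_birkhoffAverage_le {T : Ω → Ω} {g : Ω → ℝ} {C : ℝ} (hC : ∀ x, |g x| ≤ C) (n : ℕ)
    (x : Ω) : |birkhoffAverage ℝ T g n x| ≤ C := by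
  have hC0 : 0 ≤ C := (abs_nonneg _).trans (hC x)
  rcases Nat.eq_zero_or_pos n with rfl | hn
  · simpa using hC0
  have hn' : (0 : ℝ) < n := by exact_mod_cast hn
  rw [birkhoffAverage, smul_eq_mul, abs_mul, abs_of_pos (inv_pos.2 hn'), inv_mul_le_iff₀ hn']
  calc |birkhoffSum T g n x| ≤ ∑ k ∈ Finset.range n, |g (T^[k] x)| := Finset.abs_sum_le_sum_abs _ _
    _ ≤ ∑ _k ∈ Finset.range n, C := Finset.sum_le_sum fun _ _ => hC _
    _ = n * C := by simp

theorem measurable_birkhoffAverage {T : Ω → Ω} (hT : Measurable T) {g : Ω → ℝ} (hg : Measurable g)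
    (n : ℕ) : Measurable (birkhoffAverage ℝ T g n) := by
  have : Measurable (birkhoffSum T g n) :=
    Finset.measurable_sum _ fun k _ => hg.comp (hT.iterate k)
  exact this.const_smul (n : ℝ)⁻¹

theorem isBoundedUnder_of_abs_le {u : ℕ → ℝ} {C : ℝ} (h : ∀ n, |u n| ≤ C) :
    IsBoundedUnder (· ≤ ·) atTop u := isBoundedUnder_of ⟨C, fun n => (abs_le.1 (h n)).2⟩

theorem isCoboundedUnder_of_abs_le {u : ℕ → ℝ} {C : ℝ} (h : ∀ n, |u n| ≤ C) :
    IsCoboundedUnder (· ≤ ·) atTop u :=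
  IsBoundedUnder.isCoboundedUnder_le (isBoundedUnder_of ⟨-C, fun n => (abs_le.1 (h n)).1⟩)

/-- The upper half of the pointwise ergodic theorem for bounded functions. -/
theorem Ergodic.ae_limsup_birkhoffAverage_le [IsProbabilityMeasure μ] {T : Ω → Ω}
    (hT : Ergodic T μ) {g : Ω → ℝ} (hg : Measurable g) {C : ℝ} (hC : ∀ x, |g x| ≤ C) :
    ∀ᵐ x ∂μ, limsup (fun n => birkhoffAverage ℝ T g n x) atTop ≤ ∫ x, g x ∂μ := by
  have hgi : Integrable g μ := Integrable.of_bound hg.aestronglyMeasurable C (ae_of_all _ hC)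
  have hb := fun x => isBoundedUnder_of_abs_le (abs_birkhoffAverage_le (T := T) hC · x)
  have hcb := fun x => isCoboundedUnder_of_abs_le (abs_birkhoffAverage_le (T := T) hC · x)
  set L : Ω → ℝ := fun x => limsup (fun n => birkhoffAverage ℝ T g n x) atTop with hL
  have hLm : Measurable L := Measurable.limsup fun n => measurable_birkhoffAverage hT.measurable hg n
  have hbd : Bornology.IsBounded (Set.range g) :=
    isBounded_iff_forall_norm_le.2 ⟨C, by rintro _ ⟨x, rfl⟩; exact hC x⟩
  have hLT : ∀ x, L (T x) = L x := by
    intro x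
    have h0 := tendsto_birkhoffAverage_apply_sub_birkhoffAverage' ℝ hbd T x
    rw [hL]
    dsimp only
    apply le_antisymm
    · refine le_of_forall_pos_le_add fun ε hε => ?_
      rw [← limsup_add_const atTop _ ε (hb x) (hcb x)]
      refine limsup_le_limsup ?_ (hcb (T x)) ?_
      · filter_upwards [h0.eventually_lt_const hε] with n hn
        linarith
      · exact isBoundedUnder_of ⟨C + ε, fun n => by
          have := (abs_le.1 (abs_birkhoffAverage_le (T := T) hC n x)).2
          linarith⟩
    · refine le_of_forall_pos_le_add fun ε hε => ?_
      rw [← limsup_add_const atTop _ ε (hb (T x)) (hcb (T x))]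
      refine limsup_le_limsup ?_ (hcb x) ?_
      · filter_upwards [h0.eventually_const_lt (neg_lt_zero.2 hε)] with n hn
        linarith
      · exact isBoundedUnder_of ⟨C + ε, fun n => by
          have := (abs_le.1 (abs_birkhoffAverage_le (T := T) hC n (T x))).2
          linarith⟩
  -- The invariant set `{q < L}` is null or full. If full, some Birkhoff sum of `g - q` is positive
  -- almost everywhere, so the maximal theorem gives `q ≤ ∫ g`. Rational `q` keep the null sets
  -- countable.
  have hq : ∀ q : ℚ, ∫ x, g x ∂μ < q → ∀ᵐ x ∂μ, L x ≤ q := by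
    intro q hq
    have hB : MeasurableSet {x | (q : ℝ) < L x} := measurableSet_lt measurable_const hLm
    rcases hT.toPreErgodic.ae_mem_or_ae_notMem hB (by ext x; simp [hLT]) with h | h
    · exfalso
      have hm : Measurable fun x => g x - q := hg.sub_const _
      have := integral_nonneg_of_exists_birkhoffSum_pos hT.toMeasurePreserving hm
        (hgi.sub (integrable_const _)) (by
          filter_upwards [h] with x hx
          obtain ⟨n, hn, hn0⟩ := ((frequently_lt_of_lt_limsup (hcb x) hx).and_eventually
            (eventually_gt_atTop 0)).exists
          refine ⟨n, ?_⟩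
          have hn' : (0 : ℝ) < n := by exact_mod_cast hn0
          rw [birkhoffAverage, smul_eq_mul, lt_inv_mul_iff₀ hn'] at hn
          have : birkhoffSum T (fun x => g x - q) n x = birkhoffSum T g n x - n * q := by
            simp [birkhoffSum]
          rw [this]
          linarith)
      rw [integral_sub hgi (integrable_const _)] at this
      simp at this
      linarith
    · filter_upwards [h] with x hx
      exact not_lt.1 hx
  have hall : ∀ᵐ x ∂μ, ∀ q : ℚ, ∫ x, g x ∂μ < q → L x ≤ q := by
    rw [ae_all_iff]
    intro q
    by_cases h : ∫ x, g x ∂μ < q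
    · filter_upwards [hq q h] with x hx _ using hx
    · exact ae_of_all _ fun x h' => absurd h' h
  filter_upwards [hall] with x hx
  refine le_of_forall_gt_imp_ge_of_dense fun a ha => ?_
  obtain ⟨q, h1, h2⟩ := exists_rat_btwn ha
  exact (hx q h1).trans h2.le

end MaximalErgodic

/-! ### An invariant Hahn–Banach theorem. -/

section InvariantFunctional

variable {V : Type*} [AddCommGroup V] [Module ℝ V]

/-- A sublinear functional which does not increase under `U` dominates a `U`-invariant linear
functional, whose value at a given vector can be prescribed to be the limit of the means of the
sublinear functional along the partial orbit sums of that vector. -/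
theorem exists_invariant_linear_le_sublinear (U : V →ₗ[ℝ] V) (q : V → ℝ)
    (hadd : ∀ v w, q (v + w) ≤ q v + q w) (hsmul : ∀ c : ℝ, 0 < c → ∀ v, q (c • v) = c * q v)
    (hU : ∀ v, q (U v) ≤ q v) (v₀ : V) :
    ∃ Λ : V →ₗ[ℝ] ℝ, (∀ v, Λ v ≤ q v) ∧ (∀ v, Λ (U v) = Λ v) ∧
      ∀ L : ℝ, (∀ n : ℕ, 0 < n → n * L ≤ q (∑ k ∈ Finset.range n, (U ^ k) v₀)) → L ≤ Λ v₀ := by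
  set s : ℕ → V → V := fun n v => ∑ k ∈ Finset.range n, (U ^ k) v with hs
  have hq0 : q 0 = 0 := by
    have := hsmul 2 two_pos 0
    rw [smul_zero] at this
    linarith
  have hneg : ∀ v, -q (-v) ≤ q v := fun v => by
    have := hadd v (-v)
    rw [add_neg_cancel, hq0] at this
    linarith
  have hUp : ∀ n v, q ((U ^ n) v) ≤ q v := by
    intro n v
    induction n with
    | zero => simp
    | succ n ih =>
      rw [pow_succ', Module.End.mul_apply]
      exact (hU _).trans ih
  have hs_neg : ∀ n v, s n (-v) = -s n v := fun n v => by simp [hs]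
  have hs_add : ∀ n v w, s n (v + w) = s n v + s n w := fun n v w => by
    simp [hs, Finset.sum_add_distrib]
  have hs_smul : ∀ n (c : ℝ) v, s n (c • v) = c • s n v := fun n c v => by
    simp [hs, Finset.smul_sum]
  have hsub : ∀ v, Subadditive fun n => q (s n v) := by
    intro v m n
    have : s (m + n) v = s m v + (U ^ m) (s n v) := by
      simp only [hs]
      rw [Finset.sum_range_add, map_sum]
      congr 1
      exact Finset.sum_congr rfl fun k _ => by rw [pow_add, Module.End.mul_apply]
    dsimp only
    rw [this]
    exact (hadd _ _).trans (by have := hUp m (s n v); linarith)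
  have hle : ∀ n v, q (s n v) ≤ n * q v := by
    intro n v
    induction n with
    | zero => simp [hs, hq0]
    | succ n ih =>
      have h1 := hsub v n 1
      have h2 : s 1 v = v := by simp [hs]
      dsimp only at h1
      rw [h2] at h1
      push_cast
      linarith
  have hbdd : ∀ v, BddBelow (Set.range fun n : ℕ => q (s n v) / n) := by
    intro v
    refine ⟨-|q (-v)|, ?_⟩
    rintro _ ⟨n, rfl⟩
    rcases Nat.eq_zero_or_pos n with rfl | hn
    · simp
    have hn' : (0 : ℝ) < n := by exact_mod_cast hn
    have h1 := hneg (s n v)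
    rw [← hs_neg] at h1
    have h2 := hle n (-v)
    have h3 := mul_le_mul_of_nonneg_left (le_abs_self (q (-v))) hn'.le
    dsimp only
    rw [le_div_iff₀ hn']
    linarith
  -- Averaging along orbits gives a sublinear `p ≤ q` that is nonpositive on every `v - U v`, so any
  -- linear functional below `p` is invariant.
  set p : V → ℝ := fun v => (hsub v).lim with hp
  have hlim : ∀ v, Tendsto (fun n : ℕ => q (s n v) / n) atTop (nhds (p v)) := fun v =>
    (hsub v).tendsto_lim (hbdd v)
  have hpadd : ∀ v w, p (v + w) ≤ p v + p w := fun v w =>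
    le_of_tendsto_of_tendsto' (hlim _) ((hlim v).add (hlim w)) fun n => by
      rw [hs_add, ← add_div]
      exact div_le_div_of_nonneg_right (hadd _ _) n.cast_nonneg
  have hpsmul : ∀ c : ℝ, 0 < c → ∀ v, p (c • v) = c * p v := fun c hc v =>
    tendsto_nhds_unique (hlim _) (((hlim v).const_mul c).congr fun n => by
      rw [hs_smul, hsmul c hc, mul_div_assoc])
  have hple : ∀ v, p v ≤ q v := fun v => by
    have := (hsub v).lim_le_div (hbdd v) one_ne_zero
    simpa [hs] using this
  have hp0 : p 0 = 0 := by
    have := hpsmul 2 two_pos 0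
    rw [smul_zero] at this
    linarith
  have hpneg : ∀ v, -p (-v) ≤ p v := fun v => by
    have := hpadd v (-v)
    rw [add_neg_cancel, hp0] at this
    linarith
  have hex : ∃ Λ : V →ₗ[ℝ] ℝ, Λ v₀ = p v₀ ∧ ∀ v, Λ v ≤ p v := by
    by_cases hv : v₀ = 0
    · obtain ⟨g, -, hg2⟩ := exists_extension_of_le_sublinear (⊥ : V →ₗ.[ℝ] ℝ) p hpsmul hpadd
        (by
          rintro ⟨x, hx⟩
          obtain rfl : x = 0 := (Submodule.mem_bot ℝ).1 hx
          rw [hp0]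
          exact (map_zero (⊥ : V →ₗ.[ℝ] ℝ).toFun).le)
      exact ⟨g, by rw [hv, map_zero, hp0], hg2⟩
    · obtain ⟨g, hg1, hg2⟩ := exists_extension_of_le_sublinear
        (LinearPMap.mkSpanSingleton v₀ (p v₀) hv) p hpsmul hpadd
        (by
          rintro ⟨x, hx⟩
          obtain ⟨c, rfl⟩ := Submodule.mem_span_singleton.1 hx
          refine (LinearPMap.mkSpanSingleton'_apply v₀ (p v₀) _ c hx).trans_le ?_
          rw [RingHom.id_apply, smul_eq_mul]
          rcases lt_trichotomy c 0 with hc | rfl | hc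
          · have h1 := hpsmul (-c) (neg_pos.2 hc) v₀
            have h2 := hpneg (c • v₀)
            rw [← neg_smul, h1] at h2
            dsimp only
            linarith
          · simp [hp0]
          · exact (hpsmul c hc v₀).ge)
      refine ⟨g, ?_, hg2⟩
      have := hg1 ⟨v₀, Submodule.mem_span_singleton_self v₀⟩
      rw [this]
      have h := LinearPMap.mkSpanSingleton_apply ℝ ℝ (σ := RingHom.id ℝ) hv (p v₀)
      exact h
  obtain ⟨Λ, h1, h2⟩ := hex
  have hinv : ∀ v, p (v - U v) ≤ 0 := by
    intro v
    have hz : Tendsto (fun n : ℕ => (q v + q (-v)) / n) atTop (nhds 0) :=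
      tendsto_const_nhds.div_atTop tendsto_natCast_atTop_atTop
    refine le_of_tendsto_of_tendsto' (hlim _) hz fun n => ?_
    refine div_le_div_of_nonneg_right ?_ n.cast_nonneg
    -- The orbit sums of `v - U v` telescope, so `q` of them stays bounded above and the mean has
    -- limit at most zero.
    have : s n (v - U v) = v + (U ^ n) (-v) := by
      have := Finset.sum_range_sub' (fun k => (U ^ k) v) n
      simp only [hs, map_sub, map_neg, ← sub_eq_add_neg]
      rw [pow_zero, Module.End.one_apply] at this
      rw [← this]
      exact Finset.sum_congr rfl fun k _ => by rw [pow_succ, Module.End.mul_apply]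
    rw [this]
    exact (hadd _ _).trans (by have := hUp n (-v); linarith)
  refine ⟨Λ, fun v => (h2 v).trans (hple v), fun v => ?_, fun L hL => ?_⟩
  · have a1 := (h2 _).trans (hinv v)
    have a2 := (h2 _).trans (hinv (-v))
    simp only [map_sub, map_neg] at a1 a2
    linarith
  · rw [h1]
    refine ge_of_tendsto (hlim v₀) ?_
    filter_upwards [eventually_gt_atTop 0] with n hn
    have hn' : (0 : ℝ) < n := by exact_mod_cast hn
    rw [le_div_iff₀ hn', mul_comm]
    exact hL n hn

end InvariantFunctional

/-! ### Invariant measures from sublinear functionals. -/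

section InvariantMeasure

variable {Y : Type*} [TopologicalSpace Y] [T2Space Y] [CompactSpace Y] [MeasurableSpace Y]
  [BorelSpace Y]

open CompactlySupported in
theorem exists_probabilityMeasure_of_positive (Λ : C(Y, ℝ) →ₗ[ℝ] ℝ)
    (hpos : ∀ f : C(Y, ℝ), (∀ y, 0 ≤ f y) → 0 ≤ Λ f) (hone : Λ 1 = 1) :
    ∃ μ : Measure Y, IsProbabilityMeasure μ ∧ ∀ f : C(Y, ℝ), ∫ y, f y ∂μ = Λ f := by
  let Λ₀ : C_c(Y, ℝ) →ₗ[ℝ] ℝ :=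
    { toFun := fun f => Λ f.toContinuousMap
      map_add' := fun f g => Λ.map_add f.toContinuousMap g.toContinuousMap
      map_smul' := fun c f => Λ.map_smul c f.toContinuousMap }
  let Λ' : C_c(Y, ℝ) →ₚ[ℝ] ℝ := PositiveLinearMap.mk₀ Λ₀ fun f hf => hpos _ fun y => hf y
  have h : ∀ f : C(Y, ℝ), ∫ y, f y ∂(RealRMK.rieszMeasure Λ') = Λ f := fun f =>
    RealRMK.integral_rieszMeasure Λ' ⟨f, HasCompactSupport.of_compactSpace f⟩
  have hfin : IsFiniteMeasure (RealRMK.rieszMeasure Λ') := by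
    have : (RealRMK.rieszMeasure Λ').Regular := inferInstance
    infer_instance
  refine ⟨RealRMK.rieszMeasure Λ', ⟨?_⟩, h⟩
  have h1 := h 1
  simp only [ContinuousMap.one_apply, integral_const, smul_eq_mul, mul_one, hone] at h1
  rw [← ENNReal.ofReal_toReal (measure_ne_top (RealRMK.rieszMeasure Λ') Set.univ)]
  rw [Measure.real] at h1
  simp [h1]

/-- A monotone normalised sublinear functional on continuous functions which does not increase
under the Koopman operator dominates the integral against some invariant probability. -/
theorem exists_invariant_measure_le_sublinear [HasOuterApproxClosed Y] (T : C(Y, Y))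
    (q : C(Y, ℝ) → ℝ)
    (hadd : ∀ f g, q (f + g) ≤ q f + q g) (hsmul : ∀ c : ℝ, 0 < c → ∀ f, q (c • f) = c * q f)
    (hnonpos : ∀ f : C(Y, ℝ), (∀ y, f y ≤ 0) → q f ≤ 0) (hone : q 1 ≤ 1) (hneg : q (-1) ≤ -1)
    (hT : ∀ f, q (f.comp T) ≤ q f) (f₀ : C(Y, ℝ)) :
    ∃ μ : Measure Y, IsProbabilityMeasure μ ∧ MeasurePreserving T μ μ ∧
      (∀ f : C(Y, ℝ), ∫ y, f y ∂μ ≤ q f) ∧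
      ∀ L : ℝ, (∀ n : ℕ, 0 < n → ∀ g : C(Y, ℝ), (∀ y, g y = birkhoffSum T f₀ n y) → n * L ≤ q g) →
        L ≤ ∫ y, f₀ y ∂μ := by
  let U : C(Y, ℝ) →ₗ[ℝ] C(Y, ℝ) :=
    { toFun := fun f => f.comp T
      map_add' := fun _ _ => rfl
      map_smul' := fun _ _ => rfl }
  obtain ⟨Λ, h1, h2, h3⟩ := exists_invariant_linear_le_sublinear U q hadd hsmul hT f₀
  obtain ⟨μ, hμ, hμΛ⟩ := exists_probabilityMeasure_of_positive Λ
    (fun f hf => by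
      have := (h1 (-f)).trans (hnonpos _ fun y => neg_nonpos.2 (hf y))
      rw [map_neg] at this
      linarith)
    (by
      have a1 := (h1 1).trans hone
      have a2 := (h1 (-1)).trans hneg
      rw [map_neg] at a2
      linarith)
  refine ⟨μ, hμ, ⟨T.continuous.measurable, ?_⟩, fun f => (hμΛ f).trans_le (h1 f), fun L hL => ?_⟩
  · have : IsProbabilityMeasure (μ.map T) :=
      Measure.isProbabilityMeasure_map T.continuous.measurable.aemeasurable
    refine ext_of_forall_integral_eq_of_IsFiniteMeasure fun f => ?_
    rw [integral_map T.continuous.measurable.aemeasurable f.continuous.aestronglyMeasurable]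
    exact (hμΛ (f.toContinuousMap.comp T)).trans ((h2 _).trans (hμΛ f.toContinuousMap).symm)
  · rw [hμΛ]
    refine h3 L fun n hn => hL n hn _ fun y => ?_
    have hUk : ∀ k : ℕ, ∀ f : C(Y, ℝ), ((U ^ k) f) y = f (T^[k] y) := by
      intro k
      induction k with
      | zero => intro f; rfl
      | succ k ih =>
        intro f
        rw [pow_succ, Module.End.mul_apply, ih, Function.iterate_succ_apply']
        rfl
    simp [birkhoffSum, ContinuousMap.coe_sum, hUk]

end InvariantMeasure

/-! ### Ergodic maximizing measures. -/

section MaximizingMeasure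

variable {Y : Type*} [TopologicalSpace Y] [T2Space Y] [CompactSpace Y] [MeasurableSpace Y]
  [BorelSpace Y] [HasOuterApproxClosed Y]

/-- An upper semicontinuous convex function on the simplex of invariant probability measures
attains its maximum at an ergodic measure. -/
theorem exists_ergodic_isMaxOn {T : Y → Y} (hT : Continuous T) (G : Measure Y → ℝ)
    (husc : UpperSemicontinuousOn (fun μ : ProbabilityMeasure Y => G μ)
      {μ | MeasurePreserving T (μ : Measure Y) μ})
    (hconv : ∀ μ₁ μ₂ : Measure Y, IsProbabilityMeasure μ₁ → IsProbabilityMeasure μ₂ →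
      MeasurePreserving T μ₁ μ₁ → MeasurePreserving T μ₂ μ₂ → ∀ a b : ℝ≥0, a + b = 1 →
      G (a • μ₁ + b • μ₂) ≤ a * G μ₁ + b * G μ₂)
    (hne : ∃ μ : Measure Y, IsProbabilityMeasure μ ∧ MeasurePreserving T μ μ) :
    ∃ μ : Measure Y, IsProbabilityMeasure μ ∧ Ergodic T μ ∧
      ∀ ν : Measure Y, IsProbabilityMeasure ν → MeasurePreserving T ν ν → G ν ≤ G μ := by
  set M : Set (ProbabilityMeasure Y) := {μ | MeasurePreserving T (μ : Measure Y) μ} with hM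
  have hMc : IsClosed M := by
    have : M = {μ : ProbabilityMeasure Y | μ.map hT.measurable.aemeasurable = μ} := by
      ext μ
      constructor
      · intro h
        exact Subtype.ext h.map_eq
      · intro h
        exact ⟨hT.measurable, congrArg Subtype.val h⟩
    rw [this]
    exact isClosed_eq (ProbabilityMeasure.continuous_map hT) continuous_id
  obtain ⟨μ₀, hμ₀, hμ₀T⟩ := hne
  obtain ⟨μ₁, hμ₁, hmax⟩ := husc.exists_isMaxOn ⟨⟨μ₀, hμ₀⟩, hμ₀T⟩ hMc.isCompact
  set K : Set (ProbabilityMeasure Y) := M ∩ {μ | G μ₁ ≤ G μ} with hK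
  have hKc : IsClosed K := by
    refine isClosed_of_closure_subset fun μ hμ => ?_
    have hμM : μ ∈ M := hMc.closure_subset (closure_mono Set.inter_subset_left hμ)
    refine ⟨hμM, ?_⟩
    by_contra hlt
    have hev := husc μ hμM (G μ₁) (not_le.1 hlt)
    rw [eventually_nhdsWithin_iff] at hev
    obtain ⟨ν, hν, hνM, hνG⟩ := mem_closure_iff_nhds.1 hμ _ hev
    exact absurd (hν hνM) (not_lt.2 hνG)
  -- Integration against test functions carries the compact set `K` of maximizers into a locally
  -- convex space, where a nonempty compact set has an extreme point.
  let Φ : ProbabilityMeasure Y → (C(Y, ℝ) → ℝ) := fun μ f => ∫ y, f y ∂(μ : Measure Y)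
  have hΦ : Continuous Φ := continuous_pi fun f =>
    ProbabilityMeasure.continuous_integral_continuousMap f
  have hΦi : Function.Injective Φ := fun μ ν h => by
    refine ProbabilityMeasure.toMeasure_injective
      (ext_of_forall_integral_eq_of_IsFiniteMeasure fun f => ?_)
    exact congrFun h f.toContinuousMap
  obtain ⟨v, hv⟩ := (hKc.isCompact.image hΦ).extremePoints_nonempty ⟨Φ μ₁, μ₁, ⟨hμ₁, le_refl (G μ₁)⟩, rfl⟩
  obtain ⟨⟨μ, hμK, rfl⟩, hext⟩ := hv
  refine ⟨μ, inferInstance, Ergodic.of_mem_extremePoints ⟨⟨hμK.1, inferInstance⟩, ?_⟩, ?_⟩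
  · rintro ν₁ ⟨h₁, hp₁⟩ ν₂ ⟨h₂, hp₂⟩ ⟨a, b, ha, hb, hab, hμ⟩
    have hat : a ≠ ⊤ := fun h => by simp [h] at hab
    have hbt : b ≠ ⊤ := fun h => by simp [h] at hab
    lift a to ℝ≥0 using hat
    lift b to ℝ≥0 using hbt
    have hab' : a + b = 1 := by exact_mod_cast hab
    have habr : (a : ℝ) + b = 1 := by exact_mod_cast hab'
    have ha' : (0 : ℝ) < a := by exact_mod_cast ha
    have hb' : (0 : ℝ) < b := by exact_mod_cast hb
    have hμ' : a • ν₁ + b • ν₂ = (μ : Measure Y) := hμ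
    -- By convexity, a maximizer that is a mixture with positive weights has both components
    -- maximal. An extreme point of `K` is thus extreme among all invariant probabilities.
    have hG := hconv ν₁ ν₂ hp₁ hp₂ h₁ h₂ a b hab'
    rw [hμ'] at hG
    have g₁ : G ν₁ ≤ G μ₁ := hmax (show (⟨ν₁, hp₁⟩ : ProbabilityMeasure Y) ∈ M from h₁)
    have g₂ : G ν₂ ≤ G μ₁ := hmax (show (⟨ν₂, hp₂⟩ : ProbabilityMeasure Y) ∈ M from h₂)
    have g₀ : G μ₁ ≤ G μ := hμK.2
    have he : (a : ℝ) * G μ₁ + b * G μ₁ = G μ₁ := by rw [← add_mul, habr, one_mul]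
    have k₁ : G μ₁ ≤ G ν₁ := le_of_mul_le_mul_left
      (by linarith [mul_le_mul_of_nonneg_left g₂ hb'.le]) ha'
    have k₂ : G μ₁ ≤ G ν₂ := le_of_mul_le_mul_left
      (by linarith [mul_le_mul_of_nonneg_left g₁ ha'.le]) hb'
    have := hext (x₁ := Φ ⟨ν₁, hp₁⟩) ⟨⟨ν₁, hp₁⟩, ⟨h₁, k₁⟩, rfl⟩ (x₂ := Φ ⟨ν₂, hp₂⟩)
      ⟨⟨ν₂, hp₂⟩, ⟨h₂, k₂⟩, rfl⟩ ⟨a, b, ha', hb', habr, by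
        funext f
        have i₁ : Integrable f ν₁ := f.continuous.integrable_of_hasCompactSupport
          (HasCompactSupport.of_compactSpace f)
        have i₂ : Integrable f ν₂ := f.continuous.integrable_of_hasCompactSupport
          (HasCompactSupport.of_compactSpace f)
        simp only [Φ, Pi.add_apply, Pi.smul_apply, ← hμ']
        rw [integral_add_measure (i₁.smul_measure_nnreal) (i₂.smul_measure_nnreal),
          integral_smul_nnreal_measure, integral_smul_nnreal_measure]
        rfl⟩
    exact congrArg Subtype.val (hΦi this)
  · intro ν hν hνT
    have : G ν ≤ G μ₁ := hmax (show (⟨ν, hν⟩ : ProbabilityMeasure Y) ∈ M from hνT)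
    exact this.trans hμK.2

end MaximizingMeasure

/-! ### Joint continuity, fibrewise suprema and bounds on Birkhoff sums. -/

theorem continuous_uncurry_of_holderWith {Ω X Z : Type*} [PseudoEMetricSpace Ω]
    [TopologicalSpace X] [PseudoEMetricSpace Z] {f : Ω → X → Z} (hf : ∀ ω, Continuous (f ω))
    {C β : ℝ≥0} (hβ : 0 < β) (hH : ∀ t, HolderWith C β (fun ω => f ω t)) :
    Continuous fun p : Ω × X => f p.1 p.2 := by
  refine continuous_iff_continuousAt.2 fun ⟨ω₀, t₀⟩ => ?_
  rw [ContinuousAt, tendsto_iff_edist_tendsto_0]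
  have h1 : Tendsto (fun p : Ω × X => (C : ENNReal) * edist p.1 ω₀ ^ (β : ℝ)) (nhds (ω₀, t₀))
      (nhds 0) := by
    have : Continuous fun p : Ω × X => (C : ENNReal) * edist p.1 ω₀ ^ (β : ℝ) :=
      (ENNReal.continuous_const_mul ENNReal.coe_ne_top).comp
        (ENNReal.continuous_rpow_const.comp (continuous_fst.edist continuous_const))
    have h := this.tendsto (ω₀, t₀)
    simpa [ENNReal.zero_rpow_of_pos (show (0 : ℝ) < β from hβ)] using h
  have h2 : Tendsto (fun p : Ω × X => edist (f ω₀ p.2) (f ω₀ t₀)) (nhds (ω₀, t₀)) (nhds 0) := by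
    have : Continuous fun p : Ω × X => edist (f ω₀ p.2) (f ω₀ t₀) :=
      ((hf ω₀).comp continuous_snd).edist continuous_const
    simpa using this.tendsto (ω₀, t₀)
  have h3 := h1.add h2
  rw [add_zero] at h3
  refine tendsto_of_tendsto_of_tendsto_of_le_of_le tendsto_const_nhds h3 (fun _ => zero_le)
    fun p => ?_
  exact (edist_triangle _ (f ω₀ p.2) _).trans (add_le_add_left (hH p.2 p.1 ω₀) _)

section FiberSup

variable {Ω X : Type*} [TopologicalSpace Ω] [TopologicalSpace X] [CompactSpace X] [Nonempty X]

theorem continuous_fiberSup {f : Ω × X → ℝ} (hf : Continuous f) :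
    Continuous fun ω => ⨆ t, f (ω, t) := by
  have := isCompact_univ.continuous_sSup (f := fun ω t => f (ω, t)) (K := (Set.univ : Set X)) hf
  simpa only [Set.image_univ, sSup_range] using this

theorem bddAbove_fiber {f : Ω × X → ℝ} (hf : Continuous f) (ω : Ω) :
    BddAbove (Set.range fun t => f (ω, t)) :=
  isCompact_range (hf.comp (Continuous.prodMk_right ω)) |>.bddAbove

theorem le_fiberSup {f : Ω × X → ℝ} (hf : Continuous f) (ω : Ω) (t : X) :
    f (ω, t) ≤ ⨆ t, f (ω, t) := le_ciSup (bddAbove_fiber hf ω) t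

end FiberSup

theorem abs_ciSup_le {ι : Type*} [Nonempty ι] {u : ι → ℝ} {C : ℝ} (h : ∀ i, |u i| ≤ C) :
    |⨆ i, u i| ≤ C := by
  refine abs_le.2 ⟨?_, ciSup_le fun i => (abs_le.1 (h i)).2⟩
  obtain ⟨i⟩ := ‹Nonempty ι›
  exact (abs_le.1 (h i)).1.trans
    (le_ciSup (f := u) ⟨C, by rintro _ ⟨j, rfl⟩; exact (abs_le.1 (h j)).2⟩ i)

section BirkhoffBounds

variable {Y : Type*} {T : Y → Y} {ψ : Y → ℝ} {C : ℝ}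

theorem birkhoffSum_le_birkhoffSum_iterate (hC : ∀ y, |ψ y| ≤ C) (n m : ℕ) (y : Y) :
    birkhoffSum T ψ n y ≤ birkhoffSum T ψ n (T^[m] y) + m * (2 * C) := by
  induction m with
  | zero => simp
  | succ m ih =>
    rw [Function.iterate_succ_apply']
    have h := birkhoffSum_apply_sub_birkhoffSum T ψ n (T^[m] y)
    have h1 := abs_le.1 (hC (T^[n] (T^[m] y)))
    have h2 := abs_le.1 (hC (T^[m] y))
    push_cast
    linarith

/-- The double sum adds up the sums of length `n` started at times `0, …, m - 1`, and starting at
time `k` costs at most `2 C k`. This replaces long sums of `ψ` by sums of the fixed block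
`birkhoffSum T ψ m`. -/
theorem mul_birkhoffSum_le (hC : ∀ y, |ψ y| ≤ C) (n m : ℕ) (y : Y) :
    m * birkhoffSum T ψ n y ≤
      birkhoffSum T (birkhoffSum T ψ m) n y + m * (m * (2 * C)) := by
  have hC0 : 0 ≤ C := (abs_nonneg _).trans (hC y)
  induction m with
  | zero => simp [birkhoffSum]
  | succ m ih =>
    have h1 := birkhoffSum_le_birkhoffSum_iterate (T := T) hC n m y
    have h2 : birkhoffSum T (birkhoffSum T ψ (m + 1)) n y =
        birkhoffSum T (birkhoffSum T ψ m) n y + birkhoffSum T ψ n (T^[m] y) := by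
      simp only [birkhoffSum, ← Finset.sum_add_distrib]
      refine Finset.sum_congr rfl fun j _ => ?_
      rw [Finset.sum_range_succ, ← Function.iterate_add_apply, ← Function.iterate_add_apply,
        add_comm m j]
    rw [h2]
    have h3 : (0 : ℝ) ≤ m := m.cast_nonneg
    push_cast
    nlinarith [mul_nonneg h3 hC0]

end BirkhoffBounds

/-! ### The skew product: comparing the potential with its fibrewise maximum. -/

namespace MarkovShift

variable {S : Type*} {A : S → S → Prop}

instance instSecondCountableTopology [Finite S] : SecondCountableTopology (MarkovShift A) :=
  EMetric.secondCountable_of_sigmaCompact _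

section Skew

variable [Finite S] {X : Type*} [MetricSpace X] [CompactSpace X] [Nonempty X]
  [MeasurableSpace X] [BorelSpace X] {F : MarkovShift A → X → X} {φ : X → MarkovShift A → ℝ}

theorem iterate_skewProduct_fst (n : ℕ) (p : MarkovShift A × X) :
    ((skewProduct F)^[n] p).1 = shift^[n] p.1 := by
  induction n generalizing p with
  | zero => rfl
  | succ n ih => rw [Function.iterate_succ_apply, ih, Function.iterate_succ_apply]; rfl

theorem continuous_skewProduct (hF : Continuous fun p : MarkovShift A × X => F p.1 p.2) :
    Continuous (skewProduct F) :=
  (continuous_shift.comp continuous_fst).prodMk hF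

theorem continuous_birkhoffSum {Y : Type*} [TopologicalSpace Y] {T : Y → Y} (hT : Continuous T)
    {ψ : Y → ℝ} (hψ : Continuous ψ) (n : ℕ) : Continuous (birkhoffSum T ψ n) :=
  continuous_finsetSum _ fun k _ => hψ.comp (hT.iterate k)

theorem continuous_birkhoffAverage {Y : Type*} [TopologicalSpace Y] {T : Y → Y} (hT : Continuous T)
    {ψ : Y → ℝ} (hψ : Continuous ψ) (n : ℕ) : Continuous (birkhoffAverage ℝ T ψ n) :=
  (continuous_birkhoffSum hT hψ n).const_smul (n : ℝ)⁻¹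

theorem exists_abs_jointPotential_le (hφ : Continuous (jointPotential φ)) :
    ∃ C, ∀ p, |jointPotential φ p| ≤ C := by
  obtain ⟨C, hC⟩ := (isCompact_range hφ).isBounded.exists_norm_le
  exact ⟨C, fun p => hC _ ⟨p, rfl⟩⟩

theorem measurable_maxInstability (hF : Continuous fun p : MarkovShift A × X => F p.1 p.2)
    (hφ : Continuous (jointPotential φ)) : Measurable (maxInstability F φ) :=
  Measurable.limsup fun n => (continuous_fiberSup
    (continuous_birkhoffAverage (continuous_skewProduct hF) hφ n)).measurable

theorem abs_fiberSup_birkhoffAverage_le {C : ℝ} (hC : ∀ p, |jointPotential φ p| ≤ C)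
    (ω : MarkovShift A) (n : ℕ) :
    |⨆ t : X, birkhoffAverage ℝ (skewProduct F) (jointPotential φ) n (ω, t)| ≤ C :=
  abs_ciSup_le fun t => abs_birkhoffAverage_le hC n (ω, t)

theorem abs_maxInstability_le {C : ℝ} (hC : ∀ p, |jointPotential φ p| ≤ C) (ω : MarkovShift A) :
    |maxInstability F φ ω| ≤ C := by
  have h := abs_fiberSup_birkhoffAverage_le (F := F) hC ω
  refine abs_le.2 ⟨?_, ?_⟩
  · exact le_limsup_of_frequently_le
      (Frequently.of_forall fun n => (abs_le.1 (h n)).1) (isBoundedUnder_of_abs_le h)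
  · exact limsup_le_of_le (isCoboundedUnder_of_abs_le h)
      (Eventually.of_forall fun n => (abs_le.1 (h n)).2)

theorem integrable_maxInstability (hF : Continuous fun p : MarkovShift A × X => F p.1 p.2)
    (hφ : Continuous (jointPotential φ)) (ν : Measure (MarkovShift A)) [IsFiniteMeasure ν] :
    Integrable (maxInstability F φ) ν := by
  obtain ⟨C, hC⟩ := exists_abs_jointPotential_le hφ
  exact Integrable.of_bound (measurable_maxInstability hF hφ).aestronglyMeasurable C
    (ae_of_all _ (abs_maxInstability_le hC))

/-- The upper ergodic bound for the negated potential bounds the lower limit of the averages at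
almost every `(ω, t)` from below by the integral, and the supremum over the fibre dominates these
averages. -/
theorem integral_jointPotential_le (hF : Continuous fun p : MarkovShift A × X => F p.1 p.2)
    (hφ : Continuous (jointPotential φ)) {μ : Measure (MarkovShift A × X)} [IsProbabilityMeasure μ]
    (hμ : Ergodic (skewProduct F) μ) :
    ∫ p, jointPotential φ p ∂μ ≤ ∫ ω, maxInstability F φ ω ∂(μ.map Prod.fst) := by
  obtain ⟨C, hC⟩ := exists_abs_jointPotential_le hφ
  have hm := measurable_maxInstability hF hφ
  have hae := hμ.ae_limsup_birkhoffAverage_le (g := fun p => -jointPotential φ p)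
    hφ.measurable.neg (C := C) (by simpa using hC)
  rw [integral_neg] at hae
  rw [integral_map measurable_fst.aemeasurable hm.aestronglyMeasurable]
  calc ∫ p, jointPotential φ p ∂μ = ∫ _p, (∫ p, jointPotential φ p ∂μ) ∂μ := by simp
    _ ≤ ∫ p, maxInstability F φ p.1 ∂μ := by
      refine integral_mono_ae (integrable_const _) ?_ ?_
      · exact Integrable.of_bound (hm.comp measurable_fst).aestronglyMeasurable C
          (ae_of_all _ fun p => abs_maxInstability_le hC p.1)
      · filter_upwards [hae] with p hp
        have hC' : ∀ p, |(fun p => -jointPotential φ p) p| ≤ C := by simpa using hC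
        have hb := (abs_birkhoffAverage_le (T := skewProduct F) hC' · p)
        refine le_of_forall_lt_imp_le_of_dense fun a ha => ?_
        have hlt : limsup (fun n => birkhoffAverage ℝ (skewProduct F)
            (fun p => -jointPotential φ p) n p) atTop < -a := by linarith
        have hev := eventually_lt_of_limsup_lt hlt (isBoundedUnder_of_abs_le hb)
        refine le_limsup_of_frequently_le (Eventually.frequently ?_)
          (isBoundedUnder_of_abs_le (abs_fiberSup_birkhoffAverage_le hC p.1))
        filter_upwards [hev] with n hn
        have h1 : birkhoffAverage ℝ (skewProduct F) (fun p => -jointPotential φ p) n p =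
            -birkhoffAverage ℝ (skewProduct F) (jointPotential φ) n p := by
          simp [birkhoffAverage, birkhoffSum]
        rw [h1] at hn
        have h2 := le_fiberSup (continuous_birkhoffAverage (continuous_skewProduct hF) hφ n) p.1 p.2
        exact (neg_lt_neg_iff.1 hn).le.trans h2

/-- Sums over blocks of length `m` are at most the fibre maximum `a` at the base point, whatever the
fibre coordinate. So `m` times a long average is at most a shift average of `a` up to `O(1/n)`, and
the ergodic bound for `ν` applies to `a`. -/
theorem ae_maxInstability_le (hF : Continuous fun p : MarkovShift A × X => F p.1 p.2)
    (hφ : Continuous (jointPotential φ)) {ν : Measure (MarkovShift A)} [IsProbabilityMeasure ν]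
    (hν : Ergodic shift ν) {m : ℕ} (hm : 0 < m) :
    ∀ᵐ ω ∂ν, m * maxInstability F φ ω ≤
      ∫ ω, (⨆ t : X, birkhoffSum (skewProduct F) (jointPotential φ) m (ω, t)) ∂ν := by
  obtain ⟨C, hC⟩ := exists_abs_jointPotential_le hφ
  have hT := continuous_skewProduct hF
  have hm' : (0 : ℝ) < m := by exact_mod_cast hm
  have hSc := continuous_birkhoffSum hT hφ m
  set a : MarkovShift A → ℝ := fun ω =>
    ⨆ t : X, birkhoffSum (skewProduct F) (jointPotential φ) m (ω, t) with ha
  have hac : Continuous a := continuous_fiberSup hSc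
  have haC : ∃ D, ∀ ω, |a ω| ≤ D := by
    obtain ⟨D, hD⟩ := (isCompact_range hac).isBounded.exists_norm_le
    exact ⟨D, fun p => hD _ ⟨p, rfl⟩⟩
  obtain ⟨D, hD⟩ := haC
  filter_upwards [hν.ae_limsup_birkhoffAverage_le hac.measurable hD] with ω hω
  refine le_trans ?_ hω
  have hb := (abs_birkhoffAverage_le (T := shift) hD · ω)
  refine le_of_forall_gt_imp_ge_of_dense fun c hc => ?_
  have hev := eventually_lt_of_limsup_lt hc (isBoundedUnder_of_abs_le hb)
  rw [← le_div_iff₀' hm']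
  refine le_of_forall_pos_le_add fun ε hε => ?_
  have hz : Tendsto (fun n : ℕ => (m * (2 * C)) / (n : ℝ)) atTop (nhds 0) :=
    tendsto_const_nhds.div_atTop tendsto_natCast_atTop_atTop
  refine limsup_le_of_le (isCoboundedUnder_of_abs_le (abs_fiberSup_birkhoffAverage_le hC ω)) ?_
  filter_upwards [hev, hz.eventually_lt_const hε, eventually_gt_atTop 0] with n hn hn2 hn0
  have hn' : (0 : ℝ) < n := by exact_mod_cast hn0
  refine ciSup_le fun t => ?_
  have h1 := mul_birkhoffSum_le (T := skewProduct F) hC n m (ω, t)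
  have h2 : birkhoffSum (skewProduct F) (birkhoffSum (skewProduct F) (jointPotential φ) m) n (ω, t) ≤
      birkhoffSum shift a n ω := by
    refine Finset.sum_le_sum fun j _ => ?_
    have h := le_fiberSup hSc ((skewProduct F)^[j] (ω, t)).1 ((skewProduct F)^[j] (ω, t)).2
    rw [iterate_skewProduct_fst] at h
    refine le_trans (le_of_eq ?_) h
    rw [← iterate_skewProduct_fst (F := F) j (ω, t)]
  rw [birkhoffAverage, smul_eq_mul, inv_mul_lt_iff₀ hn'] at hn
  rw [div_lt_iff₀ hn'] at hn2
  rw [birkhoffAverage, smul_eq_mul, inv_mul_le_iff₀ hn']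
  refine le_of_mul_le_mul_left ?_ hm'
  have h3 : (m : ℝ) * (n * (c / m + ε)) = n * c + m * (n * ε) := by field_simp
  rw [h3]
  have h4 := mul_le_mul_of_nonneg_left hn2.le hm'.le
  linarith

/-- The functional `f ↦ ∫ sup_t f(ω, t) dν` does not increase under the skew product, because `ν` is
invariant. On functions of `ω` alone it is integration against `ν`, so testing `f` and `-f` fixes
the marginal. Its values on Birkhoff sums of the potential are bounded below by
`ae_maxInstability_le`. -/
theorem exists_invariant_lift (hF : Continuous fun p : MarkovShift A × X => F p.1 p.2)
    (hφ : Continuous (jointPotential φ)) {ν : Measure (MarkovShift A)} [IsProbabilityMeasure ν]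
    (hν : Ergodic shift ν) :
    ∃ μ : Measure (MarkovShift A × X), IsProbabilityMeasure μ ∧
      MeasurePreserving (skewProduct F) μ μ ∧ μ.map Prod.fst = ν ∧
      ∫ ω, maxInstability F φ ω ∂ν ≤ ∫ p, jointPotential φ p ∂μ := by
  have hi : ∀ g : MarkovShift A → ℝ, Continuous g → Integrable g ν := fun g hg =>
    hg.integrable_of_hasCompactSupport (HasCompactSupport.of_compactSpace g)
  have hsupi : ∀ f : C(MarkovShift A × X, ℝ), Integrable (fun ω => ⨆ t, f (ω, t)) ν := fun f =>
    hi _ (continuous_fiberSup f.continuous)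
  obtain ⟨μ, hμ, hinv, hle, hL⟩ := exists_invariant_measure_le_sublinear
    ⟨skewProduct F, continuous_skewProduct hF⟩
    (fun f : C(MarkovShift A × X, ℝ) => ∫ ω, (⨆ t, f (ω, t)) ∂ν)
    (fun f g => by
      rw [← integral_add (hsupi f) (hsupi g)]
      exact integral_mono (hsupi _) ((hsupi f).add (hsupi g)) fun ω => ciSup_le fun t =>
        add_le_add (le_fiberSup f.continuous ω t) (le_fiberSup g.continuous ω t))
    (fun c hc f => by
      rw [← integral_const_mul]
      congr 1
      funext ω
      exact (Real.mul_iSup_of_nonneg hc.le _).symm)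
    (fun f hf => integral_nonpos fun ω => ciSup_le fun t => hf _)
    (by simp) (by simp)
    (fun f => by
      have hcomp : ∫ ω, (⨆ t, f (ω, t)) ∂ν = ∫ ω, (⨆ t, f (shift ω, t)) ∂ν := by
        have hc := continuous_fiberSup f.continuous
        conv_lhs => rw [← hν.map_eq]
        rw [integral_map hν.measurable.aemeasurable hc.aestronglyMeasurable]
      rw [hcomp]
      refine integral_mono (hsupi _) (hi _ ((continuous_fiberSup f.continuous).comp
        continuous_shift)) fun ω => ciSup_le fun t => ?_
      exact le_fiberSup f.continuous (shift ω) (F ω t))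
    ⟨jointPotential φ, hφ⟩
  have hmap : IsProbabilityMeasure (μ.map Prod.fst) :=
    Measure.isProbabilityMeasure_map measurable_fst.aemeasurable
  refine ⟨μ, hμ, hinv, ?_, ?_⟩
  · refine ext_of_forall_integral_eq_of_IsFiniteMeasure fun f => ?_
    rw [integral_map measurable_fst.aemeasurable f.continuous.aestronglyMeasurable]
    have h1 := hle (f.toContinuousMap.comp ⟨Prod.fst, continuous_fst⟩)
    have h2 := hle (-f.toContinuousMap.comp ⟨Prod.fst, continuous_fst⟩)
    simp only [ContinuousMap.comp_apply, ContinuousMap.coe_mk, ciSup_const,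
      ContinuousMap.neg_apply, integral_neg] at h1 h2
    exact le_antisymm h1 (neg_le_neg_iff.1 h2)
  · refine hL _ fun n hn g hg => ?_
    rw [← integral_const_mul]
    have hae := ae_maxInstability_le hF hφ hν hn
    have hle2 := integral_mono_ae ((integrable_maxInstability hF hφ ν).const_mul (n : ℝ))
      (integrable_const _) hae
    refine hle2.trans (le_of_eq ?_)
    rw [integral_const]
    simp only [probReal_univ, one_smul, hg]
    rfl

end Skew

/-! ### Semicontinuity of entropy and the maximizing measure. -/

section Entropy

variable [Fintype S]

theorem upperSemicontinuous_entropyRate :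
    UpperSemicontinuous fun μ : ProbabilityMeasure (MarkovShift A) =>
      entropyRate (μ : Measure (MarkovShift A)) shift head := by
  -- Each quotient is weakly continuous: cylinders are clopen, so their frontier is empty and their
  -- measure varies continuously.
  refine upperSemicontinuous_ciInf (fun μ => ⟨0, ?_⟩) fun n => Continuous.upperSemicontinuous ?_
  · rintro _ ⟨n, rfl⟩
    exact div_nonneg (partitionEntropy_nonneg _ _) (by positivity)
  · refine Continuous.div_const (continuous_finsetSum _ fun w _ =>
      Real.continuous_negMulLog.comp ?_) _
    refine continuous_iff_continuousAt.2 fun μ => ?_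
    have h := ProbabilityMeasure.tendsto_measure_of_null_frontier_of_tendsto
      (tendsto_id (x := nhds μ)) (E := itinerary shift (head (A := A)) (n + 1) ⁻¹' {w})
      (by rw [(isClopen_itinerary_preimage (n + 1) w).frontier_eq]; simp)
    have h' := (NNReal.continuous_coe.tendsto _).comp h
    exact h'

theorem measureEntropy_shift (ν : Measure (MarkovShift A)) [IsProbabilityMeasure ν]
    (hν : MeasurePreserving shift ν ν) :
    measureEntropy shift ν = entropyRate ν shift head :=
  measureEntropy_eq_entropyRate ν hν measurableCells_head measurableSpace_eq_generateFrom

variable {X : Type*} [MetricSpace X] [CompactSpace X] [Nonempty X]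
  [MeasurableSpace X] [BorelSpace X] {F : MarkovShift A → X → X} {φ : X → MarkovShift A → ℝ}

theorem measurePreserving_map_fst {μ : Measure (MarkovShift A × X)}
    (hμ : MeasurePreserving (skewProduct F) μ μ) :
    MeasurePreserving shift (μ.map Prod.fst) (μ.map Prod.fst) := by
  have hs : Measurable (shift : MarkovShift A → MarkovShift A) := continuous_shift.measurable
  refine ⟨hs, ?_⟩
  rw [Measure.map_map hs measurable_fst]
  conv_rhs => rw [← hμ.map_eq]
  rw [Measure.map_map measurable_fst hμ.measurable]
  rfl

/-- The comparison is with every invariant measure because the lifts of base measures need not be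
ergodic. -/
theorem exists_ergodic_maximizer [Nonempty (MarkovShift A)]
    (hF : Continuous fun p : MarkovShift A × X => F p.1 p.2)
    (hφ : Continuous (jointPotential φ)) :
    ∃ μ : Measure (MarkovShift A × X), IsProbabilityMeasure μ ∧ Ergodic (skewProduct F) μ ∧
      ∀ ν : Measure (MarkovShift A × X), IsProbabilityMeasure ν →
        MeasurePreserving (skewProduct F) ν ν →
        entropyRate (ν.map Prod.fst) shift head + ∫ p, jointPotential φ p ∂ν ≤
          entropyRate (μ.map Prod.fst) shift head + ∫ p, jointPotential φ p ∂μ := by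
  have hT := continuous_skewProduct hF
  refine exists_ergodic_isMaxOn hT
    (fun μ => entropyRate (μ.map Prod.fst) shift head + ∫ p, jointPotential φ p ∂μ) ?_ ?_ ?_
  · have h1 : UpperSemicontinuous fun μ : ProbabilityMeasure (MarkovShift A × X) =>
        entropyRate ((μ : Measure (MarkovShift A × X)).map Prod.fst) shift head := by
      have h := UpperSemicontinuous.comp (upperSemicontinuous_entropyRate (A := A))
        (ProbabilityMeasure.continuous_map (continuous_fst (X := MarkovShift A) (Y := X)))
      simpa only [Function.comp_def, ProbabilityMeasure.toMeasure_map] using h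
    have h2 : Continuous fun μ : ProbabilityMeasure (MarkovShift A × X) =>
        ∫ p, jointPotential φ p ∂(μ : Measure (MarkovShift A × X)) :=
      ProbabilityMeasure.continuous_integral_continuousMap
        (⟨jointPotential φ, hφ⟩ : C(MarkovShift A × X, ℝ))
    exact (h1.add h2.upperSemicontinuous).upperSemicontinuousOn _
  · intro μ₁ μ₂ hp₁ hp₂ h₁ h₂ a b hab
    have hi : ∀ μ : Measure (MarkovShift A × X), IsProbabilityMeasure μ →
        Integrable (jointPotential φ) μ := fun μ _ =>
      hφ.integrable_of_hasCompactSupport (HasCompactSupport.of_compactSpace _)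
    have hm₁ : IsProbabilityMeasure (μ₁.map Prod.fst) :=
      Measure.isProbabilityMeasure_map measurable_fst.aemeasurable
    have hm₂ : IsProbabilityMeasure (μ₂.map Prod.fst) :=
      Measure.isProbabilityMeasure_map measurable_fst.aemeasurable
    have he := entropyRate_convexComb_le hab (measurePreserving_map_fst h₁)
      (measurePreserving_map_fst h₂) (ξ := head) measurableCells_head
    rw [Measure.map_add _ _ measurable_fst, Measure.map_smul, Measure.map_smul,
      integral_add_measure (hi _ hp₁).smul_measure_nnreal (hi _ hp₂).smul_measure_nnreal,
      integral_smul_nnreal_measure, integral_smul_nnreal_measure, NNReal.smul_def, NNReal.smul_def,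
      smul_eq_mul, smul_eq_mul]
    linarith
  · have hb : ∀ f : C(MarkovShift A × X, ℝ), BddAbove (Set.range f) := fun f =>
      (isCompact_range f.continuous).bddAbove
    -- An invariant probability exists: the global supremum serves as the sublinear functional, and
    -- the prescribed vector `0` plays no role.
    obtain ⟨μ, hμ, hinv, -⟩ := exists_invariant_measure_le_sublinear
      ⟨skewProduct F, hT⟩ (fun f : C(MarkovShift A × X, ℝ) => ⨆ p, f p)
      (fun f g => ciSup_le fun p => add_le_add (le_ciSup (hb f) p) (le_ciSup (hb g) p))
      (fun c hc f => (Real.mul_iSup_of_nonneg hc.le _).symm)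
      (fun f hf => ciSup_le hf) (by simp) (by simp)
      (fun f => ciSup_le fun p => le_ciSup (hb f) _) 0
    exact ⟨μ, hμ, hinv⟩

end Entropy

end MarkovShift

end

/-! ### The variational principle. -/

theorem mainTheorem4 {S : Type*} [Finite S] (A : S → S → Prop) [Nonempty (MarkovShift A)]
    {X : Type*} [MetricSpace X] [CompactSpace X] [Nonempty X]
    [MeasurableSpace X] [BorelSpace X]
    (F : MarkovShift A → X ≃ₜ X) (φ : X → MarkovShift A → ℝ)
    -- every `F_ω` is an `α`-Hölder homeomorphism
    (α : ℝ≥0) (hα : 0 < α) (hF : ∀ ω, ∃ C, HolderWith C α (F ω))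
    -- `ω ↦ F_ω` is Hölder continuous for the uniform distance
    (CF β : ℝ≥0) (hβ : 0 < β) (hFω : ∀ t, HolderWith CF β (fun ω => F ω t))
    -- the potentials `φ_t` are equi-Hölder on the shift space
    (Cφ γ : ℝ≥0) (hγ : 0 < γ) (hφ : ∀ t, HolderWith Cφ γ (φ t))
    -- `t ↦ φ_t` is Hölder continuous for the uniform distance
    (Cφ' δ : ℝ≥0) (hδ : 0 < δ) (hφt : ∀ ω, HolderWith Cφ' δ (fun t => φ t ω)) :
    (∀ ν : Measure (MarkovShift A), IsProbabilityMeasure ν → Ergodic MarkovShift.shift ν →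
      Integrable (maxInstability (fun ω => F ω) φ) ν) ∧
    ∃ M : ℝ,
      IsGreatest {p : EReal | ∃ νhat : Measure (MarkovShift A × X),
        IsProbabilityMeasure νhat ∧ Ergodic (skewProduct (fun ω => F ω)) νhat ∧
        p = measureEntropy MarkovShift.shift (νhat.map Prod.fst) +
          ((∫ x, jointPotential φ x ∂νhat : ℝ) : EReal)} (M : EReal) ∧
      IsGreatest {p : EReal | ∃ ν : Measure (MarkovShift A),
        IsProbabilityMeasure ν ∧ Ergodic MarkovShift.shift ν ∧
        p = measureEntropy MarkovShift.shift ν +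
          ((∫ ω, maxInstability (fun ω => F ω) φ ω ∂ν : ℝ) : EReal)} (M : EReal) := by
  have hFc : Continuous fun p : MarkovShift A × X => F p.1 p.2 :=
    continuous_uncurry_of_holderWith (fun ω => (F ω).continuous) hβ hFω
  have hφc : Continuous (jointPotential φ) :=
    continuous_uncurry_of_holderWith (f := fun ω t => φ t ω)
      (fun ω => (hφt ω).continuous hδ) hγ hφ
  refine ⟨fun ν hν _ => MarkovShift.integrable_maxInstability hFc hφc ν, ?_⟩
  cases nonempty_fintype S
  obtain ⟨μ, hμ, hμe, hmax⟩ := MarkovShift.exists_ergodic_maximizer (F := fun ω => F ω) hFc hφc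
  have hprob : ∀ η : Measure (MarkovShift A × X), IsProbabilityMeasure η →
      IsProbabilityMeasure (η.map Prod.fst) := fun η _ =>
    Measure.isProbabilityMeasure_map measurable_fst.aemeasurable
  have hent : ∀ η : Measure (MarkovShift A × X), IsProbabilityMeasure η →
      MeasurePreserving (skewProduct fun ω => F ω) η η →
      measureEntropy MarkovShift.shift (η.map Prod.fst) =
        entropyRate (η.map Prod.fst) MarkovShift.shift MarkovShift.head := fun η hη h =>
    have := hprob η hη
    MarkovShift.measureEntropy_shift _ (MarkovShift.measurePreserving_map_fst h)
  have hupper : ∀ ν : Measure (MarkovShift A), IsProbabilityMeasure ν →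
      Ergodic MarkovShift.shift ν →
      entropyRate ν MarkovShift.shift MarkovShift.head +
          ∫ ω, maxInstability (fun ω => F ω) φ ω ∂ν ≤
        entropyRate (μ.map Prod.fst) MarkovShift.shift MarkovShift.head +
          ∫ p, jointPotential φ p ∂μ := by
    intro ν hν hνe
    obtain ⟨η, hη, hηT, rfl, hle⟩ := MarkovShift.exists_invariant_lift
      (F := fun ω => F ω) hFc hφc hνe
    have := hmax η hη hηT
    linarith
  have hμ' := hprob μ hμ
  have hmap : Ergodic MarkovShift.shift (μ.map Prod.fst) :=
    (measurable_fst.measurePreserving μ).ergodic_of_ergodic_semiconj hμe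
      MarkovShift.continuous_shift.measurable (fun _ => rfl)
  refine ⟨entropyRate (μ.map Prod.fst) MarkovShift.shift MarkovShift.head +
    ∫ p, jointPotential φ p ∂μ, ⟨⟨μ, hμ, hμe, ?_⟩, ?_⟩, ⟨⟨μ.map Prod.fst, hμ', hmap, ?_⟩, ?_⟩⟩
  · rw [hent μ hμ hμe.toMeasurePreserving, EReal.coe_add]
  · rintro _ ⟨η, hη, hηe, rfl⟩
    rw [hent η hη hηe.toMeasurePreserving, ← EReal.coe_add, EReal.coe_le_coe_iff]
    exact hmax η hη hηe.toMeasurePreserving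
  · rw [hent μ hμ hμe.toMeasurePreserving, ← EReal.coe_add, EReal.coe_eq_coe_iff]
    -- At the projection of `μ` the lifting bound and the ergodic bound meet, so the two functionals
    -- agree there.
    refine le_antisymm ?_ (hupper _ hμ' hmap)
    have := MarkovShift.integral_jointPotential_le (F := fun ω => F ω) hFc hφc hμe
    linarith
  · rintro _ ⟨ν, hν, hνe, rfl⟩
    rw [MarkovShift.measureEntropy_shift ν hνe.toMeasurePreserving, ← EReal.coe_add,
      EReal.coe_le_coe_iff]
    exact hupper ν hν hνe
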